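/- **Ground state preservation by the system–bath channel.** Setting: $H$ is a Hermitian $N\times N$ matrix whose two lowest eigenvalues, counted with multiplicity, are $\lambda_0<\lambda_1$; $\Delta=\lambda_1-\lambda_0>0$ is the spectral gap and $|\psi_0\rangle$ the unit ground state. $\|\cdot\|$ is the operator norm and $\|\cdot\|_1$ the trace norm. $\mathcal A$ is a nonempty finite set of $N\times N$ matrices, closed under $A\mapsto -A$ and $A\mapsto A^\dagger$, with $\|A\|\le 1$ for all $A\in\mathcal A$, and $g$ is a probability density on $\mathbb R$. For $\sigma>0$ let $$f(t)=(2\pi)^{-1/4}\sigma^{-1/2}e^{-t^2/(4\sigma^2)},\qquad H_E=-\tfrac{\omega}{2}Z,\qquad B_E=|1\rangle\langle 0|,$$ $$H_\alpha(t)=H\otimes I+I\otimes H_E+\alpha f(t)\,(A\otimes B_E+A^\dagger\otimes B_E^\dagger),\qquad U^\alpha(T)=\mathcal T\exp\Big(-i\int_{-T}^{T}H_\alpha(s)\,ds\Big),$$ and $$\Phi_\alpha(\rho)=\mathbb E_{A,\omega}\big[\mathrm{Tr}_E\big(U^\alpha(T)(\rho\otimes\rho_E)U^\alpha(T)^\dagger\big)\big],$$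 where $A$ is uniform in $\mathcal A$, $\omega$ has density $g$, and $\rho_E$ is the ground state of $H_E$ ($\beta=\infty$), that is, $|0\rangle\langle 0|$ if $\omega\ge 0$ and $|1\rangle\langle 1|$ if $\omega<0$ (so always $|0\rangle\langle 0|$ when $g$ is supported on $[0,\infty)$). **Theorem.** For every $K>0$ there is a constant $C>0$, depending only on $K$, such that the following holds for all $N,H,\mathcal A,g$ as above and all $\sigma,T,\alpha>0$ with $\alpha\le K\sigma^{-1/2}$. 1. For every $\epsilon>0$, if $$\sigma\ \ge\ \frac{C}{\Delta}\log^{3/2}\!\Big(2+\frac{\|H\|}{\Delta^2\epsilon}\Big),\qquad T\ \ge\ C\,\sigma\,\log^{1/2}\!\Big(2+\frac{\sigma}{\epsilon}\Big),$$ then $$\big\|\Phi_\alpha(|\psi_0\rangle\langle\psi_0|)-|\psi_0\rangle\langle\psi_0|\big\|_1<\alpha^2\epsilon .$$ 2. Let $\tau$ be the integer mixing time of $\Phi_\alpha$, i.e. the least $t\in\mathbb N$ with $\|\Phi_\alpha^t(\rho_1)-\Phi_\alpha^t(\rho_2)\|_1\le\frac12\|\rho_1-\rho_2\|_1$ for all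 density matrices $\rho_1,\rho_2$ (assumed to exist), let $t_{\rm mix}=\alpha^2\tau$ be the rescaled mixing time, and let $\rho_{\rm fix}$ be a density matrix with $\Phi_\alpha(\rho_{\rm fix})=\rho_{\rm fix}$. For every $\epsilon>0$, if $$\sigma\ \ge\ \frac{C}{\Delta}\log^{3/2}\!\Big(2+\frac{\|H\|\,t_{\rm mix}}{\Delta^2\epsilon}\Big),\qquad T\ \ge\ C\,\sigma\,\log^{1/2}\!\Big(2+\frac{\sigma\, t_{\rm mix}}{\epsilon}\Big),$$ then $$\big\|\rho_{\rm fix}-|\psi_0\rangle\langle\psi_0|\big\|_1\le\epsilon .$$ -/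

import Mathlib

/- The norm `‖A‖` of a complex square matrix is its operator norm with respect to the Euclidean
norm, and the order on matrices (used by `CFC.abs`) is the Loewner order. -/
open scoped Matrix Kronecker Matrix.Norms.L2Operator MatrixOrder ComplexOrder

namespace SystemBath

noncomputable section

/-- The trace norm `‖A‖₁ = Tr √(A†A)`. -/
def traceNorm {m : Type*} [Fintype m] [DecidableEq m] (A : Matrix m m ℂ) : ℝ :=
  (CFC.abs A).trace.re

/-- Density matrices: positive semidefinite matrices of trace one. -/
def IsDensity {m : Type*} [Fintype m] (ρ : Matrix m m ℂ) : Prop :=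
  ρ.PosSemidef ∧ ρ.trace = 1

/-- The rank-one operator `|ψ⟩⟨ψ|`. -/
def ketbra {m : Type*} (ψ : m → ℂ) : Matrix m m ℂ :=
  Matrix.vecMulVec ψ (star ψ)

/-- The partial trace over the second tensor factor. -/
def partialTrace {m e : Type*} [Fintype e] (M : Matrix (m × e) (m × e) ℂ) : Matrix m m ℂ :=
  Matrix.of fun i j => ∑ b, M (i, b) (j, b)

/-- The `n`-th term of the time-ordered exponential of `∫ K`:
`∫_{t₀ ≤ sₙ ≤ ⋯ ≤ s₁ ≤ t} K(s₁) ⋯ K(sₙ) dsₙ ⋯ ds₁`, as an iterated integral. -/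
def dysonTerm {m : Type*} [Fintype m] [DecidableEq m] (K : ℝ → Matrix m m ℂ) (t₀ : ℝ) :
    ℕ → ℝ → Matrix m m ℂ
  | 0, _ => 1
  | n + 1, t => ∫ s in t₀..t, K s * dysonTerm K t₀ n s

/-- The time-ordered exponential `𝒯 exp (∫_{t₀}^t K(s) ds)`. -/
def timeOrderedExp {m : Type*} [Fintype m] [DecidableEq m] (K : ℝ → Matrix m m ℂ)
    (t₀ t : ℝ) : Matrix m m ℂ :=
  ∑' n, dysonTerm K t₀ n t

/-- The bath Hamiltonian `H_E = -ω Z / 2` of a single qubit. -/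
def bathHamiltonian (ω : ℝ) : Matrix (Fin 2) (Fin 2) ℂ :=
  (-(ω : ℂ) / 2) • !![1, 0; 0, -1]

/-- The bath coupling operator `B_E = (X - i Y) / 2 = |1⟩⟨0|`. -/
def bathCoupling : Matrix (Fin 2) (Fin 2) ℂ :=
  !![0, 0; 1, 0]

/-- The ground state of `H_E = -ω Z / 2`: it is `|0⟩⟨0|` for `ω ≥ 0` and `|1⟩⟨1|` for `ω < 0`. -/
def bathGround (ω : ℝ) : Matrix (Fin 2) (Fin 2) ℂ :=
  if 0 ≤ ω then !![1, 0; 0, 0] else !![0, 0; 0, 1]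

/-- The Gaussian control function `f(t) = (2π)^{-1/4} σ^{-1/2} exp (-t² / (4σ²))`. -/
def control (σ t : ℝ) : ℝ :=
  1 / ((2 * Real.pi) ^ (1 / 4 : ℝ) * σ ^ (1 / 2 : ℝ)) * Real.exp (-t ^ 2 / (4 * σ ^ 2))

variable {N : ℕ}

/-- The total Hamiltonian
`H_α(t) = H + H_E + α f(t) (A ⊗ B_E + A† ⊗ B_E†)` on system and bath. -/
def totalHamiltonian (H A : Matrix (Fin N) (Fin N) ℂ) (ω σ α t : ℝ) :
    Matrix (Fin N × Fin 2) (Fin N × Fin 2) ℂ :=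
  H ⊗ₖ (1 : Matrix (Fin 2) (Fin 2) ℂ) + (1 : Matrix (Fin N) (Fin N) ℂ) ⊗ₖ bathHamiltonian ω
    + ((α * control σ t : ℝ) : ℂ) • (A ⊗ₖ bathCoupling + Aᴴ ⊗ₖ bathCouplingᴴ)

/-- The joint evolution `U^α(T) = 𝒯 exp (-i ∫_{-T}^T H_α(s) ds)`. -/
def evolution (H A : Matrix (Fin N) (Fin N) ℂ) (ω σ α T : ℝ) :
    Matrix (Fin N × Fin 2) (Fin N × Fin 2) ℂ :=
  timeOrderedExp (fun s => (-Complex.I) • totalHamiltonian H A ω σ α s) (-T) T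

/-- The channel `Φ_α(ρ) = 𝔼 [Tr_E (U^α(T) (ρ ⊗ ρ_E) U^α(T)†)]` at zero temperature. The
expectation is over `A` uniform in `𝒜` and over `ω` with density `g`. -/
def channel (H : Matrix (Fin N) (Fin N) ℂ) (𝒜 : Finset (Matrix (Fin N) (Fin N) ℂ)) (g : ℝ → ℝ)
    (σ T α : ℝ) (ρ : Matrix (Fin N) (Fin N) ℂ) : Matrix (Fin N) (Fin N) ℂ :=
  (𝒜.card : ℂ)⁻¹ • ∑ A ∈ 𝒜, ∫ ω : ℝ, (g ω : ℂ) •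
    partialTrace (evolution H A ω σ α T * (ρ ⊗ₖ bathGround ω) * (evolution H A ω σ α T)ᴴ)

/-- The assumptions on the randomness of the algorithm: `𝒜` is a nonempty finite set
`{A^i, -A^i}_i` with `{(A^i)†}_i = {A^i}_i` and `‖A^i‖ ≤ 1` (that is, closed under negation and
adjoint), and `g` is a probability density on the real line. -/
structure IsAdmissible (𝒜 : Finset (Matrix (Fin N) (Fin N) ℂ)) (g : ℝ → ℝ) : Prop where
  nonempty : 𝒜.Nonempty
  neg_mem : ∀ A ∈ 𝒜, -A ∈ 𝒜
  adjoint_mem : ∀ A ∈ 𝒜, Aᴴ ∈ 𝒜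
  norm_le_one : ∀ A ∈ 𝒜, ‖A‖ ≤ 1
  density_nonneg : ∀ ω, 0 ≤ g ω
  density_integrable : MeasureTheory.Integrable g
  density_integral : ∫ ω, g ω = 1

/-- `H` is Hermitian with spectral gap `Δ` and ground state `ψ₀`. Counting multiplicity, its lowest
eigenvalue is `E₀`, with unit eigenvector `ψ₀`, and its second-lowest one is `E₀ + Δ > E₀`, the least
eigenvalue belonging to an eigenvector orthogonal to `ψ₀`. -/
structure HasGappedGroundState (H : Matrix (Fin N) (Fin N) ℂ) (Δ : ℝ) (ψ₀ : Fin N → ℂ) :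
    Prop where
  hermitian : H.IsHermitian
  gap_pos : 0 < Δ
  unit : star ψ₀ ⬝ᵥ ψ₀ = 1
  gap : ∃ E₀ : ℝ, H *ᵥ ψ₀ = (E₀ : ℂ) • ψ₀ ∧
    IsLeast {E : ℝ | ∃ φ : Fin N → ℂ, φ ≠ 0 ∧ star ψ₀ ⬝ᵥ φ = 0 ∧ H *ᵥ φ = (E : ℂ) • φ} (E₀ + Δ)

/-- `τ` is the integer mixing time of `Φ`: the least `t` such that `Φ^t` contracts the trace
distance of any two density matrices by a factor of at least two. -/
def IsMixingTime (Φ : Matrix (Fin N) (Fin N) ℂ → Matrix (Fin N) (Fin N) ℂ) (τ : ℕ) : Prop :=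
  IsLeast {t : ℕ | ∀ ρ₁ ρ₂, IsDensity ρ₁ → IsDensity ρ₂ →
    traceNorm (Φ^[t] ρ₁ - Φ^[t] ρ₂) ≤ 1 / 2 * traceNorm (ρ₁ - ρ₂)} τ

end

end SystemBath

/-!
The ground state is almost invariant because a slowly switched coupling cannot supply energy: with
the bath in its ground state, leaving `ψ₀` costs at least `Δ`, and the Gaussian control function of
width `σ` contains such a frequency only with an exponentially small amplitude.

For fixed `A` and `ω` let `a` be the free Hamiltonian of system and bath with its ground energy
subtracted, so that `a ≥ 0` annihilates the joint ground state `p = |ψ₀⟩⟨ψ₀| ⊗ ρ_E`. In the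
interaction picture the evolution is the Dyson series of `-i α f(t) e^{ita} X e^{-ita}`
(`IsEvolution.hasSum`), whose terms extend to entire functions of the end points. If the window
`[-T, T]` is enlarged to the whole line, the contour of integration may be shifted to `Im z = σ`.
There the `n`-th term is conjugated by `e^{-σa}`; it acts on `p` as the identity, and on the
complement of the ground state it is bounded by `e^{-Δσ}` (`norm_mul_propagator_le`), while `|f|`
has grown by no more than a constant factor. Enlarging the window costs the Gaussian tail
`e^{-T²/(8σ²)}`. So in every order `n` the block of the Dyson term leading from `p` out of `ψ₀` is
at most `δ xⁿ / n!`, with `δ = e^{-Δσ} + e^{-T²/(8σ²)}` and `x = 16 α √σ` (`norm_corner_le`,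
`norm_corner_gaussian_le`). All orders are treated at once, by comparing the hierarchy
`D (n + 1)' = K * D n` with a scalar one (`norm_le_of_hierarchy`).

For the reduced state this has to give an error of second order in `α`. Trace norms are tested
against observables `S` with `‖S‖ ≤ 1` (`traceNorm_le_of_forall`), and the error splits along the
final state of the bath (`norm_trace_reduced_sub_le`). If the bath returns to its ground state, the
error is linear in the leaking amplitude, but as the coupling flips the bath this amplitude has no
first-order term and is of size `δ x²`. If the bath is left excited, the error is bilinear in
amplitudes that are all of first order, one of which carries the factor `δ`. As `x² = 256 α² σ`, the
error of one run is a constant, depending on `K`, times `α² σ δ`; averaging over `A` and `ω`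
preserves this (`norm_functional_channel_sub_le`), and the lower bounds on `σ` and `T` turn it into
`α² ε` (`traceNorm_channel_ketbra_sub_lt`).

The channel contracts the trace distance of states (`traceNorm_channel_sub_le`). Hence `τ`
applications move the ground state by at most `τ` times the one-step error, while they halve its
distance to the fixed point, so that this distance is at most `2 τ` times the one-step error
(`traceNorm_sub_le_of_isMixingTime`).
-/

namespace SystemBath

open MeasureTheory Set Filter Topology

noncomputable section

/-! ### Dyson series in a C⋆-algebra -/

section Dyson

variable {𝔸 : Type*} [CStarAlgebra 𝔸]

/-- The terms of the Dyson series of `K` with base point `t₀`, in an arbitrary C⋆-algebra: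
`dysonTerm` is the special case of square matrices. -/
def dysonSeq (K : ℝ → 𝔸) (t₀ : ℝ) : ℕ → ℝ → 𝔸
  | 0, _ => 1
  | n + 1, t => ∫ s in t₀..t, K s * dysonSeq K t₀ n s

lemma dysonTerm_eq_dysonSeq {m : Type*} [Fintype m] [DecidableEq m] (K : ℝ → Matrix m m ℂ)
    (t₀ : ℝ) (n : ℕ) (t : ℝ) : dysonTerm K t₀ n t = dysonSeq K t₀ n t := by
  induction n generalizing t with
  | zero => rfl
  | succ n ih => simp only [dysonTerm, dysonSeq, ih]

variable {K : ℝ → 𝔸} {t₀ : ℝ}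

lemma continuous_dysonSeq (hK : Continuous K) (n : ℕ) : Continuous (dysonSeq K t₀ n) := by
  induction n with
  | zero => exact continuous_const
  | succ n ih =>
    exact intervalIntegral.continuous_primitive
      (fun a b => (hK.mul ih).intervalIntegrable a b) t₀

lemma hasDerivAt_dysonSeq (hK : Continuous K) (n : ℕ) (t : ℝ) :
    HasDerivAt (dysonSeq K t₀ (n + 1)) (K t * dysonSeq K t₀ n t) t :=
  intervalIntegral.integral_hasDerivAt_right
    ((hK.mul (continuous_dysonSeq hK n)).intervalIntegrable _ _)
    ((hK.mul (continuous_dysonSeq hK n)).stronglyMeasurableAtFilter _ _)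
    (hK.mul (continuous_dysonSeq hK n)).continuousAt

@[simp] lemma dysonSeq_zero (t : ℝ) : dysonSeq K t₀ 0 t = 1 := rfl

@[simp] lemma dysonSeq_succ_self (n : ℕ) : dysonSeq K t₀ (n + 1) t₀ = 0 :=
  intervalIntegral.integral_same

/-- Comparison principle for hierarchies `E (n + 1)' = K * E n`: a scalar hierarchy
`β (n + 1)' = k * β n` with `‖K‖ ≤ k` that dominates the initial values and the zeroth level
dominates every level. -/
lemma norm_le_of_hierarchy {k : ℝ → ℝ} {a b : ℝ} {E : ℕ → ℝ → 𝔸} {β : ℕ → ℝ → ℝ} (M : ℕ)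
    (hK : ∀ s ∈ Icc a b, ‖K s‖ ≤ k s)
    (hE : ∀ n, ∀ s ∈ Icc a b, HasDerivAt (E (n + 1)) (K s * E n s) s)
    (hβ : ∀ n, ∀ s ∈ Icc a b, HasDerivAt (β (n + 1)) (k s * β n s) s)
    (h0 : ∀ s ∈ Icc a b, ‖E 0 s‖ ≤ β 0 s)
    (ha : ∀ n ≤ M, ‖E n a‖ ≤ β n a) {n : ℕ} (hn : n ≤ M) {t : ℝ} (ht : t ∈ Icc a b) :
    ‖E n t‖ ≤ β n t := by
  induction n generalizing t with
  | zero => exact h0 t ht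
  | succ n ih =>
    refine image_norm_le_of_norm_deriv_right_le_deriv_boundary'
      (fun s hs => (hE n s hs).continuousAt.continuousWithinAt)
      (fun s hs => (hE n s (Ico_subset_Icc_self hs)).hasDerivWithinAt) (ha _ hn)
      (fun s hs => (hβ n s hs).continuousAt.continuousWithinAt)
      (fun s hs => (hβ n s (Ico_subset_Icc_self hs)).hasDerivWithinAt) (fun s hs => ?_) ht
    have hs' := Ico_subset_Icc_self hs
    exact (norm_mul_le _ _).trans (mul_le_mul (hK s hs') (ih (Nat.le_of_succ_le hn) hs')
      (norm_nonneg _) ((norm_nonneg _).trans (hK s hs')))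

lemma hasDerivAt_pow_div_factorial {κ : ℝ → ℝ} {k s : ℝ} (h : HasDerivAt κ k s) (n : ℕ) :
    HasDerivAt (fun t => κ t ^ (n + 1) / (n + 1).factorial) (k * (κ s ^ n / n.factorial)) s := by
  have := (h.pow (n + 1)).div_const ((n + 1).factorial : ℝ)
  refine this.congr_deriv ?_
  rw [Nat.factorial_succ]
  push_cast
  have : (n.factorial : ℝ) ≠ 0 := by positivity
  have : (n + 1 : ℝ) ≠ 0 := by positivity
  field_simp

variable [Nontrivial 𝔸]

lemma norm_dysonSeq_le (hK : Continuous K) {k κ : ℝ → ℝ} {b : ℝ}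
    (hk : ∀ s ∈ Icc t₀ b, ‖K s‖ ≤ k s) (hκ : ∀ s, HasDerivAt κ (k s) s) (hκ0 : κ t₀ = 0)
    (n : ℕ) {t : ℝ} (ht : t ∈ Icc t₀ b) :
    ‖dysonSeq K t₀ n t‖ ≤ κ t ^ n / n.factorial := by
  refine norm_le_of_hierarchy (E := dysonSeq K t₀) (β := fun n t => κ t ^ n / n.factorial) n hk
    (fun n s _ => hasDerivAt_dysonSeq hK n s)
    (fun n s _ => hasDerivAt_pow_div_factorial (hκ s) n) (by simp) (fun j _ => ?_) le_rfl ht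
  cases j <;> simp [hκ0]

lemma norm_dysonSeq_le_of_bounded (hK : Continuous K) {M : ℝ} (hM : ∀ s, ‖K s‖ ≤ M)
    (n : ℕ) (t : ℝ) : ‖dysonSeq K t₀ n t‖ ≤ (M * |t - t₀|) ^ n / n.factorial := by
  rcases le_total t₀ t with h | h
  · rw [abs_of_nonneg (sub_nonneg.2 h)]
    exact norm_dysonSeq_le hK (k := fun _ => M) (κ := fun t => M * (t - t₀)) (fun s _ => hM s)
      (fun s => by simpa using ((hasDerivAt_id s).sub_const t₀).const_mul M) (by simp) n ⟨h, le_rfl⟩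
  · rw [abs_of_nonpos (sub_nonpos.2 h)]
    -- Reflecting time at `t₀` turns this into the case `t₀ ≤ t`.
    have := norm_le_of_hierarchy (K := fun u => -K (t₀ - u)) (k := fun _ => M) (a := 0)
      (b := t₀ - t) (E := fun n u => dysonSeq K t₀ n (t₀ - u))
      (β := fun n u => (M * u) ^ n / n.factorial) n (fun s _ => by simpa using hM _)
      (fun n s _ => by
        exact ((hasDerivAt_dysonSeq (t₀ := t₀) hK n (t₀ - s)).comp_const_sub t₀ s).congr_deriv
          (neg_mul _ _).symm)
      (fun n s _ => hasDerivAt_pow_div_factorial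
        (by simpa using (hasDerivAt_id s).const_mul M) n)
      (by simp) (fun j _ => by cases j <;> simp) le_rfl (t := t₀ - t) ⟨by linarith, le_rfl⟩
    simpa using this

/-- The sum of the Dyson series solves the Schrödinger equation `U' = K U`. -/
lemma hasDerivAt_tsum_dysonSeq (hK : Continuous K) {M : ℝ} (hM : ∀ s, ‖K s‖ ≤ M) (t : ℝ) :
    HasDerivAt (fun t => ∑' n, dysonSeq K t₀ n t) (K t * ∑' n, dysonSeq K t₀ n t) t := by
  have hM0 : 0 ≤ M := (norm_nonneg _).trans (hM 0)
  set R := |t - t₀| + 1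
  let u : ℕ → ℝ := fun n => Nat.casesOn n 0 fun n => M * ((M * R) ^ n / n.factorial)
  have hsum : ∀ y, Summable fun n => dysonSeq K t₀ n y := fun y =>
    Summable.of_norm_bounded (Real.summable_pow_div_factorial _)
      fun n => norm_dysonSeq_le_of_bounded hK hM n y
  let D' : ℕ → ℝ → 𝔸 := fun n y => Nat.casesOn n 0 fun n => K y * dysonSeq K t₀ n y
  have hu : Summable u :=
    (summable_nat_add_iff 1).1 ((Real.summable_pow_div_factorial (M * R)).mul_left M)
  have key := hasDerivAt_tsum_of_isPreconnected (g := fun n => dysonSeq K t₀ n) (g' := D')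
    (t := Ioo (t₀ - R) (t₀ + R)) (y₀ := t) (y := t) hu isOpen_Ioo isPreconnected_Ioo
    (fun n y _ => by
      cases n with
      | zero => exact hasDerivAt_const y (1 : 𝔸)
      | succ n => exact hasDerivAt_dysonSeq hK n y)
    (fun n y hy => by
      cases n with
      | zero => simp [D', u]
      | succ n =>
        have h1 : |y - t₀| ≤ R := abs_le.2 ⟨by linarith [hy.1], by linarith [hy.2]⟩
        exact (norm_mul_le _ _).trans (mul_le_mul (hM y)
          ((norm_dysonSeq_le_of_bounded hK hM n y).trans (by gcongr)) (norm_nonneg _) hM0))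
    ⟨by have := neg_abs_le (t - t₀); simp only [R]; linarith,
      by have := le_abs_self (t - t₀); simp only [R]; linarith⟩ (hsum t)
    ⟨by have := neg_abs_le (t - t₀); simp only [R]; linarith,
      by have := le_abs_self (t - t₀); simp only [R]; linarith⟩
  refine key.congr_deriv ?_
  have h2 : Summable fun n => D' n t :=
    (summable_nat_add_iff 1).1 ((hsum t).mul_left (K t))
  rw [h2.tsum_eq_zero_add]
  exact (zero_add _).trans ((hsum t).tsum_mul_left (K t))

/-- A solution of `V' = K V` with `V(t₀) = 1` is the sum of the Dyson series of `K`. -/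
lemma hasSum_dysonSeq (hK : Continuous K) {V : ℝ → 𝔸} (hV0 : V t₀ = 1)
    (hV : ∀ t, HasDerivAt V (K t * V t) t) {t : ℝ} (ht : t₀ ≤ t) :
    HasSum (fun n => dysonSeq K t₀ n t) (V t) := by
  let κ : ℝ → ℝ := fun t => ∫ s in t₀..t, ‖K s‖
  have hκ : ∀ s, HasDerivAt κ ‖K s‖ s := fun s =>
    intervalIntegral.integral_hasDerivAt_right (hK.norm.intervalIntegrable _ _)
    (hK.norm.stronglyMeasurableAtFilter _ _) hK.norm.continuousAt
  have hκ0 : κ t₀ = 0 := intervalIntegral.integral_same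
  have hVc : Continuous V := continuous_iff_continuousAt.2 fun t => (hV t).continuousAt
  obtain ⟨M, hM⟩ := isCompact_Icc.exists_bound_of_continuousOn (s := Icc t₀ t) hVc.continuousOn
  -- The remainders of the series again form a hierarchy, starting from `V`.
  have hrem : ∀ n, ‖V t - ∑ j ∈ Finset.range n, dysonSeq K t₀ j t‖ ≤
      M * (κ t ^ n / n.factorial) := fun n => by
    refine norm_le_of_hierarchy (K := K) (k := fun s => ‖K s‖) (a := t₀) (b := t)
      (E := fun n t => V t - ∑ j ∈ Finset.range n, dysonSeq K t₀ j t)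
      (β := fun n t => M * (κ t ^ n / n.factorial)) n (fun _ _ => le_rfl)
      (fun n s _ => ?_) (fun n s _ => ?_) (fun s hs => by simpa using hM s hs) (fun j _ => ?_)
      le_rfl ⟨ht, le_rfl⟩
    · have h1 : HasDerivAt (fun t => ∑ j ∈ Finset.range n, dysonSeq K t₀ (j + 1) t)
          (∑ j ∈ Finset.range n, K s * dysonSeq K t₀ j s) s :=
        HasDerivAt.fun_sum fun j _ => hasDerivAt_dysonSeq hK j s
      have h2 := (hV s).sub (h1.add_const (1 : 𝔸))
      simp only [Finset.sum_range_succ', dysonSeq_zero]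
      refine h2.congr_deriv ?_
      rw [← Finset.mul_sum, mul_sub]
    · have := (hasDerivAt_pow_div_factorial (hκ s) n).const_mul M
      refine this.congr_deriv ?_
      ring
    · cases j with
      | zero => simpa using hM t₀ ⟨le_rfl, ht⟩
      | succ j => simp [Finset.sum_range_succ', hV0, hκ0]
  have hs : Summable fun n => dysonSeq K t₀ n t :=
    Summable.of_norm_bounded (Real.summable_pow_div_factorial _)
      fun n => norm_dysonSeq_le hK (fun _ _ => le_rfl) hκ hκ0 n ⟨ht, le_rfl⟩
  rw [hs.hasSum_iff_tendsto_nat]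
  have h0 : Tendsto (fun n : ℕ => M * (κ t ^ n / n.factorial)) atTop (𝓝 0) := by
    simpa using (FloorSemiring.tendsto_pow_div_factorial_atTop (κ t)).const_mul M
  have := squeeze_zero_norm hrem h0
  simpa using (tendsto_const_nhds (x := V t)).sub this

/-- Enlarging the interval of integration changes the Dyson terms by no more than it changes
the majorants `κ ^ n / n!`. -/
lemma norm_dysonSeq_sub_le (hK : Continuous K) {k : ℝ → ℝ} (hkc : Continuous k)
    (hk : ∀ s, ‖K s‖ ≤ k s) {a' a b b' : ℝ} (ha : a' ≤ a) (hab : a ≤ b) (hb : b ≤ b') (n : ℕ) :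
    ‖dysonSeq K a' n b' - dysonSeq K a n b‖ ≤
      ((∫ s in a'..b', k s) ^ n - (∫ s in a..b, k s) ^ n) / n.factorial := by
  have hint : ∀ x y, IntervalIntegrable k volume x y := fun x y => hkc.intervalIntegrable x y
  have hκ : ∀ c s, HasDerivAt (fun t => ∫ s in c..t, k s) (k s) s := fun c s =>
    intervalIntegral.integral_hasDerivAt_right (hint _ _)
      (hkc.stronglyMeasurableAtFilter _ _) hkc.continuousAt
  have hR : ‖dysonSeq K a' n b' - dysonSeq K a' n b‖ ≤
      ((∫ s in a'..b', k s) ^ n - (∫ s in a'..b, k s) ^ n) / n.factorial := by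
    cases n with
    | zero => simp
    | succ n =>
      refine image_norm_le_of_norm_deriv_right_le_deriv_boundary (a := b) (b := b')
        (f := fun t => dysonSeq K a' (n + 1) t - dysonSeq K a' (n + 1) b)
        (B := fun t => ((∫ s in a'..t, k s) ^ (n + 1) - (∫ s in a'..b, k s) ^ (n + 1)) /
          (n + 1).factorial)
        (B' := fun s => k s * ((∫ u in a'..s, k u) ^ n / n.factorial))
        (fun s _ => ((continuous_dysonSeq hK (n + 1)).sub continuous_const).continuousWithinAt)
        (fun s _ => ((hasDerivAt_dysonSeq hK n s).sub_const _).hasDerivWithinAt) (by simp)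
        (fun s => ?_) (fun s hs => ?_) ⟨hb, le_rfl⟩
      · simp only [sub_div]
        exact (hasDerivAt_pow_div_factorial (hκ a' s) n).sub_const _
      · refine (norm_mul_le _ _).trans (mul_le_mul (hk s) ?_ (norm_nonneg _)
          ((norm_nonneg _).trans (hk s)))
        exact norm_dysonSeq_le hK (fun s _ => hk s) (hκ a') (by simp) n
          (b := s) ⟨by linarith [hs.1], le_rfl⟩
  have hL : ‖dysonSeq K a' n b - dysonSeq K a n b‖ ≤
      (∫ s in a'..b, k s) ^ n / n.factorial - (∫ s in a..b, k s) ^ n / n.factorial := by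
    refine norm_le_of_hierarchy (K := K) (k := k) (a := a) (b := b)
      (E := fun n t => dysonSeq K a' n t - dysonSeq K a n t)
      (β := fun n t => (∫ s in a'..t, k s) ^ n / n.factorial -
        (∫ s in a..t, k s) ^ n / n.factorial) n (fun s _ => hk s)
      (fun n s _ => ?_) (fun n s _ => ?_) (by simp) (fun j _ => ?_) le_rfl ⟨hab, le_rfl⟩
    · exact ((hasDerivAt_dysonSeq hK n s).fun_sub (hasDerivAt_dysonSeq hK n s)).congr_deriv
        (mul_sub _ _ _).symm
    · exact ((hasDerivAt_pow_div_factorial (hκ a' s) n).fun_sub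
        (hasDerivAt_pow_div_factorial (hκ a s) n)).congr_deriv (mul_sub _ _ _).symm
    · cases j with
      | zero => simp
      | succ j =>
        simpa using norm_dysonSeq_le hK (fun s _ => hk s) (hκ a') (by simp) (j + 1)
          (b := a) ⟨ha, le_rfl⟩
  calc _ ≤ ‖dysonSeq K a' n b' - dysonSeq K a' n b‖ + ‖dysonSeq K a' n b - dysonSeq K a n b‖ := by
        rw [← sub_add_sub_cancel]; exact norm_add_le _ _
    _ ≤ _ := (add_le_add hR hL).trans (le_of_eq (by ring))

end Dyson

/-! ### Dyson terms along a shifted contour -/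

section Contour

variable {𝔸 : Type*} [CStarAlgebra 𝔸]

/-- The Dyson terms of an entire generator `K` with base point `c`, as entire functions: each is
the primitive, vanishing at `c`, of `K` times the preceding one. -/
def dysonEntire (K : ℂ → 𝔸) (c : ℂ) : ℕ → ℂ → 𝔸
  | 0 => fun _ => 1
  | n + 1 => fun z => Complex.wedgeIntegral c z fun w => K w * dysonEntire K c n w

variable {K : ℂ → 𝔸}

lemma dysonEntire_ofReal (t₀ : ℝ) (n : ℕ) (t : ℝ) :
    dysonEntire K t₀ n t = dysonSeq (fun s : ℝ => K s) t₀ n t := by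
  induction n generalizing t with
  | zero => rfl
  | succ n ih => simp [dysonEntire, dysonSeq, Complex.wedgeIntegral, ih]

lemma hasDerivAt_wedgeIntegral {f : ℂ → 𝔸} (hf : Differentiable ℂ f) (c z : ℂ) :
    HasDerivAt (fun w => Complex.wedgeIntegral c w f) (f z) z :=
  (hf.differentiableOn.isConservativeOn (U := Metric.ball c (dist z c + 1))).hasDerivAt_wedgeIntegral
    hf.continuous.continuousOn (Metric.mem_ball.2 (lt_add_one _))

lemma differentiable_dysonEntire (hK : Differentiable ℂ K) (c : ℂ) (n : ℕ) :
    Differentiable ℂ (dysonEntire K c n) := by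
  induction n with
  | zero => exact differentiable_const _
  | succ n ih => exact fun z => (hasDerivAt_wedgeIntegral (hK.mul ih) c z).differentiableAt

lemma hasDerivAt_dysonEntire (hK : Differentiable ℂ K) (c : ℂ) (n : ℕ) (z : ℂ) :
    HasDerivAt (dysonEntire K c (n + 1)) (K z * dysonEntire K c n z) z :=
  hasDerivAt_wedgeIntegral (hK.mul (differentiable_dysonEntire hK c n)) c z

lemma norm_dysonEntire_vertical_le (hK : Differentiable ℂ K) (c : ℂ) {n : ℕ} {x η h B : ℝ}
    (hh : ∀ y ∈ Icc 0 η, ‖K (x + y * Complex.I)‖ ≤ h)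
    (hB : ∀ y ∈ Icc 0 η, ‖dysonEntire K c n (x + y * Complex.I)‖ ≤ B)
    {y : ℝ} (hy : y ∈ Icc 0 η) :
    ‖dysonEntire K c (n + 1) (x + y * Complex.I) - dysonEntire K c (n + 1) x‖ ≤ h * B * y := by
  have hd : ∀ y : ℝ, HasDerivAt (fun y : ℝ => dysonEntire K c (n + 1) (x + y * Complex.I))
      (Complex.I • (K (x + y * Complex.I) * dysonEntire K c n (x + y * Complex.I))) y := fun y => by
    have h1 : HasDerivAt (fun y : ℝ => (x : ℂ) + y * Complex.I) Complex.I y := by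
      simpa using ((Complex.ofRealCLM.hasDerivAt (x := y)).mul_const Complex.I).const_add (x : ℂ)
    exact (hasDerivAt_dysonEntire hK c n _).scomp y h1
  have := norm_image_sub_le_of_norm_deriv_right_le_segment (a := 0) (b := η) (C := h * B)
    (fun y _ => (hd y).continuousAt.continuousWithinAt) (fun y _ => (hd y).hasDerivWithinAt)
    (fun s hs => ?_) y hy
  · simpa using this
  · have hs' := Ico_subset_Icc_self hs
    rw [norm_smul, Complex.norm_I, one_mul]
    exact (norm_mul_le _ _).trans (mul_le_mul (hh s hs') (hB s hs') (norm_nonneg _)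
      ((norm_nonneg _).trans (hh s hs')))

variable [Nontrivial 𝔸] {h : ℝ → ℝ} {η : ℝ}

/-- On the strip `0 ≤ Im z ≤ η` above `[-T, T]` the entire Dyson terms are bounded uniformly
in `T`. -/
lemma exists_bound_dysonEntire (hK : Differentiable ℂ K) (hη : 0 ≤ η) (hc : Continuous h)
    (hh : ∀ x : ℝ, ∀ y ∈ Icc 0 η, ‖K (x + y * Complex.I)‖ ≤ h x) {H : ℝ} (hH : ∀ x, h x ≤ H)
    {B : ℝ} (hB : ∀ R, ∫ x in -R..R, h x ≤ B) (n : ℕ) :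
    ∃ C, 0 ≤ C ∧ ∀ T, ∀ x ∈ Icc (-T) T, ∀ y ∈ Icc 0 η,
      ‖dysonEntire K (-T : ℝ) n (x + y * Complex.I)‖ ≤ C := by
  have h0 : ∀ x, 0 ≤ h x := fun x => (norm_nonneg _).trans (hh x 0 ⟨le_rfl, hη⟩)
  have hB0 : 0 ≤ B := by simpa using hB 0
  induction n with
  | zero => exact ⟨1, zero_le_one, fun T x _ y _ => by simp [dysonEntire]⟩
  | succ n ih =>
    obtain ⟨C, hC, hbd⟩ := ih
    have hH0 : 0 ≤ H := (h0 0).trans (hH 0)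
    refine ⟨B ^ (n + 1) / (n + 1).factorial + H * C * η, by positivity, fun T x hx y hy => ?_⟩
    have h1 := norm_dysonEntire_vertical_le hK (-T : ℝ) (x := x) (n := n)
      (fun y hy => (hh x y hy).trans (hH x)) (fun y hy => hbd T x hx y hy) hy
    have hint : ∀ a b, IntervalIntegrable h volume a b := fun a b => hc.intervalIntegrable a b
    have h2 : ‖dysonEntire K (-T : ℝ) (n + 1) x‖ ≤ B ^ (n + 1) / (n + 1).factorial := by
      rw [dysonEntire_ofReal]
      refine (norm_dysonSeq_le (k := h) (κ := fun t => ∫ s in -T..t, h s)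
        (hK.continuous.comp Complex.continuous_ofReal)
        (fun s _ => by simpa using hh s 0 ⟨le_rfl, hη⟩)
        (fun s => intervalIntegral.integral_hasDerivAt_right (hint _ _)
          (hc.stronglyMeasurableAtFilter _ _) hc.continuousAt) (by simp) (n + 1) hx).trans ?_
      have h3 : ∫ s in -T..x, h s ≤ B := by
        refine le_trans ?_ (hB T)
        exact intervalIntegral.integral_mono_interval le_rfl hx.1 hx.2
          (Eventually.of_forall h0) (hint _ _)
      have h4 : 0 ≤ ∫ s in -T..x, h s :=
        intervalIntegral.integral_nonneg hx.1 fun s _ => h0 s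
      gcongr
    calc _ ≤ ‖dysonEntire K (-T : ℝ) (n + 1) x‖ + ‖dysonEntire K (-T : ℝ) (n + 1)
          (x + y * Complex.I) - dysonEntire K (-T : ℝ) (n + 1) x‖ :=
            norm_le_norm_add_norm_sub' _ _
      _ ≤ _ := add_le_add h2 (h1.trans (by gcongr; exact hy.2))

/-- Contour shift. Let `u` be invertible with inverse `v`, `v p = p`, and let `q u` be small. If the
generator decays on the strip `0 ≤ Im z ≤ η`, then the Dyson terms over `[-T, T]` may, for large
`T`, be computed on the line `Im z = η`; there they are `u`-conjugates of the Dyson terms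
of `v K u`, so that the corner `q D p` inherits the smallness of `q u`. -/
lemma eventually_norm_corner_le (hK : Differentiable ℂ K) (hη : 0 ≤ η) (hc : Continuous h)
    (hh : ∀ x : ℝ, ∀ y ∈ Icc 0 η, ‖K (x + y * Complex.I)‖ ≤ h x) {H : ℝ} (hH : ∀ x, h x ≤ H)
    {B : ℝ} (hB : ∀ R, ∫ x in -R..R, h x ≤ B)
    (hlim : Tendsto h atTop (𝓝 0)) (hlim' : Tendsto h atBot (𝓝 0))
    {u v p q : 𝔸} (huv : u * v = 1) (hvu : v * u = 1) (hp : v * p = p) (hp1 : ‖p‖ ≤ 1)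
    (hq1 : ‖q‖ ≤ 1) {k : ℝ → ℝ} (hk : Continuous k)
    (hkK : ∀ x : ℝ, ‖v * K (x + η * Complex.I) * u‖ ≤ k x) {κ : ℝ}
    (hκ : ∀ R, ∫ x in -R..R, k x ≤ κ) (n : ℕ) {γ : ℝ} (hγ : 0 < γ) :
    ∀ᶠ T in atTop, ‖q * dysonSeq (fun s : ℝ => K s) (-T) n T * p‖ ≤
      ‖q * u‖ * ((γ + κ) ^ n / n.factorial) + γ := by
  have hη' : η ∈ Icc 0 η := ⟨hη, le_rfl⟩
  choose C hC0 hC using exists_bound_dysonEntire hK hη hc hh hH hB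
  have hk0 : ∀ x, 0 ≤ k x := fun x => (norm_nonneg _).trans (hkK x)
  have hright : ∀ᶠ T in atTop, h T * C (n - 1) * η < γ := by
    have : Tendsto (fun T => h T * C (n - 1) * η) atTop (𝓝 0) := by
      simpa using (hlim.mul_const (C (n - 1))).mul_const η
    exact this.eventually (gt_mem_nhds hγ)
  have hleft : ∀ᶠ T in atTop, ∀ m ∈ Iic n,
      ‖v‖ * (h (-T) * C (m - 1) * η) * ‖u‖ < γ ^ m / m.factorial := by
    refine (eventually_all_finite (finite_Iic n)).2 fun m _ => ?_
    have : Tendsto (fun T => ‖v‖ * (h (-T) * C (m - 1) * η) * ‖u‖) atTop (𝓝 0) := by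
      simpa using ((((hlim'.comp tendsto_neg_atTop_atBot).mul_const
        (C (m - 1))).mul_const η).const_mul ‖v‖).mul_const ‖u‖
    exact this.eventually (gt_mem_nhds (by positivity))
  filter_upwards [hright, hleft, eventually_ge_atTop 0] with T hT1 hT2 hT0
  let D := dysonEntire K (-T : ℝ)
  have hTT : -T ≤ T := by linarith
  -- The conjugated Dyson terms on the shifted line form a hierarchy. They start from the small
  -- contribution of the vertical end of the contour at `-T`, for which `γ` makes room.
  have hE : ‖v * D n (T + η * Complex.I) * u‖ ≤ (γ + κ) ^ n / n.factorial := by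
    have hβ : ∀ s, HasDerivAt (fun t => γ + ∫ s in -T..t, k s) (k s) s := fun s =>
      (intervalIntegral.integral_hasDerivAt_right (hk.intervalIntegrable _ _)
        (hk.stronglyMeasurableAtFilter _ _) hk.continuousAt).const_add γ
    have := norm_le_of_hierarchy (K := fun s : ℝ => v * K (s + η * Complex.I) * u) (k := k)
      (a := -T) (b := T) (E := fun n s => v * D n (s + η * Complex.I) * u)
      (β := fun n t => (γ + ∫ s in -T..t, k s) ^ n / n.factorial) n (fun s _ => hkK s)
      (fun j s _ => ?_) (fun j s _ => hasDerivAt_pow_div_factorial (hβ s) j)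
      (fun s _ => by simp [D, dysonEntire, hvu]) (fun j hj => ?_) le_rfl (t := T) ⟨hTT, le_rfl⟩
    · refine this.trans ?_
      have : 0 ≤ ∫ s in -T..T, k s := intervalIntegral.integral_nonneg hTT fun s _ => hk0 s
      have := hκ T
      gcongr
    · have h1 : HasDerivAt (fun s : ℝ => (s : ℂ) + η * Complex.I) 1 s := by
        simpa using (Complex.ofRealCLM.hasDerivAt (x := s)).add_const (η * Complex.I)
      have h2 := (hasDerivAt_dysonEntire hK (-T : ℝ) j (s + η * Complex.I)).scomp s h1
      refine ((h2.const_mul v).mul_const u).congr_deriv ?_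
      rw [one_smul]
      calc _ = v * K (s + η * Complex.I) * 1 * D j (s + η * Complex.I) * u := by
            simp only [mul_one, mul_assoc, D]
        _ = _ := by rw [← huv]; simp only [mul_assoc]
    · cases j with
      | zero => simp [D, dysonEntire, hvu]
      | succ j =>
        have h1 := norm_dysonEntire_vertical_le hK (-T : ℝ) (n := j) (fun y hy => hh (-T) y hy)
          (fun y hy => hC j T (-T) ⟨le_rfl, hTT⟩ y hy) hη'
        have h0 : dysonEntire K (-T : ℝ) (j + 1) ((-T : ℝ) : ℂ) = 0 := by
          rw [dysonEntire_ofReal, dysonSeq_succ_self]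
        rw [h0, sub_zero] at h1
        have h2 := (hT2 (j + 1) hj).le
        simp only [intervalIntegral.integral_same, add_zero]
        refine le_trans ?_ h2
        refine (norm_mul_le _ _).trans (mul_le_mul_of_nonneg_right ?_ (norm_nonneg _))
        refine (norm_mul_le _ _).trans (mul_le_mul_of_nonneg_left ?_ (norm_nonneg _))
        simpa [D] using h1
  have hshift : ‖q * D n (T + η * Complex.I) * p‖ ≤ ‖q * u‖ * ((γ + κ) ^ n / n.factorial) := by
    have : q * D n (T + η * Complex.I) * p = q * u * (v * D n (T + η * Complex.I) * u) * p := by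
      calc _ = q * (u * v) * D n (T + η * Complex.I) * (u * v) * p := by simp [huv]
        _ = q * u * (v * D n (T + η * Complex.I) * u) * (v * p) := by simp only [mul_assoc]
        _ = _ := by rw [hp]
    rw [this]
    calc _ ≤ ‖q * u * (v * D n (T + η * Complex.I) * u)‖ * ‖p‖ := norm_mul_le _ _
      _ ≤ ‖q * u * (v * D n (T + η * Complex.I) * u)‖ * 1 := by gcongr
      _ ≤ ‖q * u‖ * ‖v * D n (T + η * Complex.I) * u‖ := by rw [mul_one]; exact norm_mul_le _ _
      _ ≤ _ := by gcongr
  have hvert : ‖D n (T + η * Complex.I) - D n T‖ ≤ γ := by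
    cases n with
    | zero => simpa [D, dysonEntire] using hγ.le
    | succ n =>
      exact (norm_dysonEntire_vertical_le hK (-T : ℝ) (fun y hy => hh T y hy)
        (fun y hy => hC n T T ⟨hTT, le_rfl⟩ y hy) hη').trans hT1.le
  rw [← dysonEntire_ofReal]
  have hsplit : q * D n T * p =
      q * D n (T + η * Complex.I) * p - q * (D n (T + η * Complex.I) - D n T) * p := by
    simp only [mul_sub, sub_mul, sub_sub_cancel]
  change ‖q * D n T * p‖ ≤ _
  rw [hsplit]
  refine (norm_sub_le _ _).trans (add_le_add hshift ?_)
  calc _ ≤ ‖q‖ * ‖D n (T + η * Complex.I) - D n T‖ * ‖p‖ :=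
        (norm_mul_le _ _).trans (mul_le_mul_of_nonneg_right (norm_mul_le _ _) (norm_nonneg _))
    _ ≤ 1 * γ * 1 := by gcongr
    _ = γ := by ring

/-- The contour-shift estimate for the Dyson terms over a finite window `[-T, T]`: besides the
factor `‖q u‖` there is the cost of extending the window to the whole line. -/
lemma norm_corner_le (hK : Differentiable ℂ K) (hη : 0 ≤ η) (hc : Continuous h)
    (hh : ∀ x : ℝ, ∀ y ∈ Icc 0 η, ‖K (x + y * Complex.I)‖ ≤ h x) {H : ℝ} (hH : ∀ x, h x ≤ H)
    {B : ℝ} (hB : ∀ R, ∫ x in -R..R, h x ≤ B)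
    (hlim : Tendsto h atTop (𝓝 0)) (hlim' : Tendsto h atBot (𝓝 0))
    {u v p q : 𝔸} (huv : u * v = 1) (hvu : v * u = 1) (hp : v * p = p) (hp1 : ‖p‖ ≤ 1)
    (hq1 : ‖q‖ ≤ 1) {k : ℝ → ℝ} (hk : Continuous k)
    (hkK : ∀ x : ℝ, ‖v * K (x + η * Complex.I) * u‖ ≤ k x) {κ : ℝ}
    (hκ : ∀ R, ∫ x in -R..R, k x ≤ κ) {k₀ : ℝ → ℝ} (hk₀ : Continuous k₀)
    (hkK₀ : ∀ x : ℝ, ‖K x‖ ≤ k₀ x) {κ₀ : ℝ} (hκ₀ : ∀ R, ∫ x in -R..R, k₀ x ≤ κ₀)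
    {T : ℝ} (hT : 0 ≤ T) (n : ℕ) :
    ‖q * dysonSeq (fun s : ℝ => K s) (-T) n T * p‖ ≤
      (‖q * u‖ * κ ^ n + (κ₀ ^ n - (∫ x in -T..T, k₀ x) ^ n)) / n.factorial := by
  have hlim0 : Tendsto (fun γ : ℝ => ‖q * u‖ * ((γ + κ) ^ n / n.factorial) + γ +
      (κ₀ ^ n - (∫ x in -T..T, k₀ x) ^ n) / n.factorial) (𝓝[>] 0)
      (𝓝 (‖q * u‖ * ((0 + κ) ^ n / n.factorial) + 0 +
        (κ₀ ^ n - (∫ x in -T..T, k₀ x) ^ n) / n.factorial)) := by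
    refine Tendsto.mono_left ?_ nhdsWithin_le_nhds
    exact Continuous.tendsto (by fun_prop) 0
  have key := ge_of_tendsto (b := ‖q * dysonSeq (fun s : ℝ => K s) (-T) n T * p‖) hlim0 ?_
  · refine key.trans (le_of_eq ?_)
    ring
  filter_upwards [self_mem_nhdsWithin] with γ hγ
  obtain ⟨T', h1, hTT'⟩ := ((eventually_norm_corner_le hK hη hc hh hH hB hlim hlim' huv hvu hp hp1
    hq1 hk hkK hκ n hγ).and (eventually_ge_atTop T)).exists
  have h2 := norm_dysonSeq_sub_le (K := fun s : ℝ => K s)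
    (hK.continuous.comp Complex.continuous_ofReal) hk₀ hkK₀ (neg_le_neg hTT')
    (by linarith : -T ≤ T) hTT' n
  set D := dysonSeq (fun s : ℝ => K s) (-T) n T
  set D' := dysonSeq (fun s : ℝ => K s) (-T') n T'
  have hsplit : q * D * p = q * D' * p - q * (D' - D) * p := by
    simp only [mul_sub, sub_mul, sub_sub_cancel]
  rw [hsplit]
  refine (norm_sub_le _ _).trans (add_le_add h1 ?_)
  have h3 : 0 ≤ ∫ x in -T'..T', k₀ x :=
    intervalIntegral.integral_nonneg (by linarith) fun s _ => (norm_nonneg _).trans (hkK₀ s)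
  calc _ ≤ ‖q‖ * ‖D' - D‖ * ‖p‖ :=
        (norm_mul_le _ _).trans (mul_le_mul_of_nonneg_right (norm_mul_le _ _) (norm_nonneg _))
    _ ≤ 1 * ‖D' - D‖ * 1 := by gcongr
    _ ≤ _ := by
      rw [one_mul, mul_one]
      refine h2.trans ?_
      have := hκ₀ T'
      gcongr

end Contour

/-! ### Free propagators -/

section Propagator

variable {𝔸 : Type*} [CStarAlgebra 𝔸]

/-- The propagator `e^{iza}` at complex time `z`. -/
def propagator (a : 𝔸) (z : ℂ) : 𝔸 := NormedSpace.exp (z • (Complex.I • a))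

lemma exp_mul_of_mul_eq_zero {b p : 𝔸} (h : b * p = 0) : NormedSpace.exp b * p = p := by
  have hs := (NormedSpace.exp_series_hasSum_exp' (𝕂 := ℂ) b).mul_right p
  have h0 : ∀ n : ℕ, n ≠ 0 → ((n.factorial : ℂ)⁻¹ • b ^ n) * p = 0 := fun n hn => by
    obtain ⟨n, rfl⟩ := Nat.exists_eq_succ_of_ne_zero hn
    rw [smul_mul_assoc, pow_succ, mul_assoc, h, mul_zero, smul_zero]
  simpa using hs.unique (hasSum_single 0 h0)

lemma propagator_mul_of_mul_eq_zero {a p : 𝔸} (h : a * p = 0) (z : ℂ) :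
    propagator a z * p = p :=
  exp_mul_of_mul_eq_zero (by simp [h])

variable (a : 𝔸)

lemma propagator_add (z w : ℂ) : propagator a (z + w) = propagator a z * propagator a w := by
  let _ : NormedAlgebra ℚ 𝔸 := .restrictScalars ℚ ℂ 𝔸
  rw [propagator, add_smul, NormedSpace.exp_add_of_commute]
  · rfl
  · exact ((Commute.refl _).smul_left _).smul_right _

@[simp] lemma propagator_zero : propagator a 0 = 1 := by simp [propagator]

@[simp] lemma propagator_mul_neg (z : ℂ) : propagator a z * propagator a (-z) = 1 := by
  rw [← propagator_add, add_neg_cancel, propagator_zero]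

@[simp] lemma propagator_neg_mul (z : ℂ) : propagator a (-z) * propagator a z = 1 := by
  rw [← propagator_add, neg_add_cancel, propagator_zero]

lemma hasDerivAt_propagator (z : ℂ) :
    HasDerivAt (propagator a) (propagator a z * (Complex.I • a)) z :=
  hasDerivAt_exp_smul_const (𝕂 := ℂ) (Complex.I • a) z

lemma differentiable_propagator : Differentiable ℂ (propagator a) :=
  fun z => (hasDerivAt_propagator a z).differentiableAt

lemma commute_propagator {a b : 𝔸} (h : Commute b a) (z : ℂ) : Commute b (propagator a z) :=
  ((h.smul_right _).smul_right _).exp_right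

lemma propagator_ofReal_mem_unitary {a : 𝔸} (ha : IsSelfAdjoint a) (t : ℝ) :
    propagator a t ∈ unitary 𝔸 := by
  let _ : NormedAlgebra ℚ 𝔸 := .restrictScalars ℚ ℂ 𝔸
  refine NormedSpace.exp_mem_unitary_of_mem_skewAdjoint ?_
  rw [skewAdjoint.mem_iff]
  simp [ha.star_eq]

lemma norm_propagator_ofReal_mul {a : 𝔸} (ha : IsSelfAdjoint a) (t : ℝ) (b : 𝔸) :
    ‖propagator a t * b‖ = ‖b‖ :=
  CStarRing.norm_mem_unitary_mul b (propagator_ofReal_mem_unitary ha t)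

lemma norm_mul_propagator_ofReal {a : 𝔸} (ha : IsSelfAdjoint a) (t : ℝ) (b : 𝔸) :
    ‖b * propagator a t‖ = ‖b‖ :=
  CStarRing.norm_mul_mem_unitary b (propagator_ofReal_mem_unitary ha t)

end Propagator

/-! ### The Gaussian control function -/

section Control

variable {σ : ℝ}

/-- The entire extension of the Gaussian control function. -/
def controlC (σ : ℝ) (z : ℂ) : ℂ :=
  (1 / ((2 * Real.pi) ^ (1 / 4 : ℝ) * σ ^ (1 / 2 : ℝ)) : ℝ) * Complex.exp (-z ^ 2 / (4 * σ ^ 2))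

lemma controlC_ofReal (σ t : ℝ) : controlC σ t = control σ t := by
  simp [controlC, control]

lemma differentiable_controlC (σ : ℝ) : Differentiable ℂ (controlC σ) := by
  unfold controlC; fun_prop

lemma continuous_control (σ : ℝ) : Continuous (control σ) := by
  unfold control; fun_prop

lemma control_pos (hσ : 0 < σ) (t : ℝ) : 0 < control σ t := by
  unfold control; positivity

lemma norm_controlC (hσ : 0 < σ) (x y : ℝ) :
    ‖controlC σ (x + y * Complex.I)‖ = control σ x * Real.exp (y ^ 2 / (4 * σ ^ 2)) := by
  have h : (-((x : ℂ) + y * Complex.I) ^ 2 / (4 * σ ^ 2)).re =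
      -x ^ 2 / (4 * σ ^ 2) + y ^ 2 / (4 * σ ^ 2) := by
    have : (-((x : ℂ) + y * Complex.I) ^ 2 / (4 * σ ^ 2)) =
        ((-x ^ 2 / (4 * σ ^ 2) + y ^ 2 / (4 * σ ^ 2) : ℝ) : ℂ) +
          ((-(2 * x * y) / (4 * σ ^ 2) : ℝ) : ℂ) * Complex.I := by
      push_cast
      linear_combination (-(y : ℂ) ^ 2 / (4 * σ ^ 2)) * Complex.I_sq
    rw [this, Complex.add_re, Complex.re_ofReal_mul]; simp only [Complex.ofReal_re]; simp
  rw [controlC, norm_mul, Complex.norm_exp, h, Real.exp_add, control, Complex.norm_real,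
    Real.norm_of_nonneg (by positivity), mul_assoc]

lemma controlC_prefactor_le (hσ : 0 < σ) :
    1 / ((2 * Real.pi) ^ (1 / 4 : ℝ) * σ ^ (1 / 2 : ℝ)) ≤ 1 / √σ := by
  rw [← Real.sqrt_eq_rpow]
  have h1 : 1 ≤ (2 * Real.pi) ^ (1 / 4 : ℝ) :=
    Real.one_le_rpow (by linarith [Real.pi_gt_three]) (by norm_num)
  have := Real.sqrt_pos.2 hσ
  gcongr
  nlinarith

lemma control_le (hσ : 0 < σ) (x : ℝ) : control σ x ≤ 1 / √σ := by
  calc control σ x ≤ 1 / ((2 * Real.pi) ^ (1 / 4 : ℝ) * σ ^ (1 / 2 : ℝ)) * 1 := by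
        unfold control
        gcongr
        rw [Real.exp_le_one_iff, neg_div]
        have : 0 ≤ x ^ 2 / (4 * σ ^ 2) := by positivity
        linarith
    _ ≤ _ := by rw [mul_one]; exact controlC_prefactor_le hσ

lemma integrable_gaussian_div {b : ℝ} (hb : 0 < b) :
    Integrable fun x : ℝ => Real.exp (-x ^ 2 / b) := by
  convert integrable_exp_neg_mul_sq (inv_pos.2 hb) using 2 with x
  congr 1; field_simp

lemma integral_gaussian_div (b : ℝ) :
    ∫ x : ℝ, Real.exp (-x ^ 2 / b) = √(Real.pi * b) := by
  have := integral_gaussian b⁻¹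
  rw [div_inv_eq_mul] at this
  rw [← this]
  congr 1 with x
  congr 1; ring

lemma integrable_control (hσ : 0 < σ) : Integrable (control σ) :=
  (integrable_gaussian_div (by positivity)).const_mul _

lemma tendsto_control (hσ : 0 < σ) : Tendsto (control σ) (cocompact ℝ) (𝓝 0) := by
  have h1 : Tendsto (fun x : ℝ => -x ^ 2 / (4 * σ ^ 2)) (cocompact ℝ) atBot := by
    have h2 : Tendsto (fun x : ℝ => ‖x‖ ^ 2) (cocompact ℝ) atTop :=
      (tendsto_pow_atTop two_ne_zero).comp (tendsto_norm_cocompact_atTop)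
    have h3 := (tendsto_neg_atTop_atBot.comp h2).atBot_div_const
      (show (0 : ℝ) < 4 * σ ^ 2 by positivity)
    simpa [Function.comp_def] using h3
  have := (Real.tendsto_exp_atBot.comp h1).const_mul
    (1 / ((2 * Real.pi) ^ (1 / 4 : ℝ) * σ ^ (1 / 2 : ℝ)))
  rw [mul_zero] at this
  exact this

lemma integral_control_le (hσ : 0 < σ) : ∫ x, control σ x ≤ 4 * √σ := by
  have hs := Real.sqrt_pos.2 hσ
  simp only [control]
  rw [integral_const_mul, integral_gaussian_div]
  have h1 : √(Real.pi * (4 * σ ^ 2)) ≤ 4 * σ := by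
    rw [Real.sqrt_le_left (by positivity)]
    nlinarith [Real.pi_le_four, sq_nonneg σ]
  calc _ ≤ 1 / √σ * (4 * σ) := by
        gcongr ?_ * ?_
        exact controlC_prefactor_le hσ
    _ = 4 * √σ := by field_simp; rw [Real.sq_sqrt hσ.le]

lemma intervalIntegral_control_le_integral (hσ : 0 < σ) (R : ℝ) :
    ∫ x in -R..R, control σ x ≤ ∫ x, control σ x := by
  rcases le_total 0 R with hR | hR
  · rw [intervalIntegral.integral_of_le (by linarith)]
    exact setIntegral_le_integral (integrable_control hσ)
      (Eventually.of_forall fun x => (control_pos hσ x).le)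
  · rw [intervalIntegral.integral_symm]
    have h1 : 0 ≤ ∫ x in R..-R, control σ x :=
      intervalIntegral.integral_nonneg (by linarith) fun x _ => (control_pos hσ x).le
    have h2 : 0 ≤ ∫ x, control σ x := integral_nonneg fun x => (control_pos hσ x).le
    linarith

lemma intervalIntegral_control_le (hσ : 0 < σ) (R : ℝ) : ∫ x in -R..R, control σ x ≤ 4 * √σ :=
  (intervalIntegral_control_le_integral hσ R).trans (integral_control_le hσ)

lemma integral_control_tail_le (hσ : 0 < σ) {T : ℝ} (hT : 0 ≤ T) :
    (∫ x, control σ x) - ∫ x in -T..T, control σ x ≤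
      6 * √σ * Real.exp (-T ^ 2 / (8 * σ ^ 2)) := by
  have hs := Real.sqrt_pos.2 hσ
  set w := 1 / ((2 * Real.pi) ^ (1 / 4 : ℝ) * σ ^ (1 / 2 : ℝ)) with hw
  have hw0 : 0 ≤ w := by positivity
  have hint : Integrable fun x : ℝ =>
      w * Real.exp (-T ^ 2 / (8 * σ ^ 2)) * Real.exp (-x ^ 2 / (8 * σ ^ 2)) :=
    (integrable_gaussian_div (by positivity)).const_mul _
  have h0 : (∫ x, control σ x) - ∫ x in -T..T, control σ x =
      ∫ x in (Ioc (-T) T)ᶜ, control σ x := by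
    rw [intervalIntegral.integral_of_le (by linarith),
      ← integral_add_compl measurableSet_Ioc (integrable_control hσ), add_sub_cancel_left]
  rw [h0]
  calc _ ≤ ∫ x in (Ioc (-T) T)ᶜ,
        w * Real.exp (-T ^ 2 / (8 * σ ^ 2)) * Real.exp (-x ^ 2 / (8 * σ ^ 2)) := by
        refine setIntegral_mono_on (integrable_control hσ).integrableOn hint.integrableOn
          measurableSet_Ioc.compl fun x hx => ?_
        have hx2 : T ^ 2 ≤ x ^ 2 := by
          simp only [mem_compl_iff, mem_Ioc, not_and, not_le] at hx
          rcases le_or_gt x (-T) with h | h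
          · nlinarith
          · nlinarith [hx h]
        rw [control, ← hw, mul_assoc, ← Real.exp_add]
        gcongr
        rw [← add_div, div_le_div_iff₀ (by positivity) (by positivity)]
        nlinarith [mul_nonneg (sub_nonneg.2 hx2) (sq_nonneg σ)]
    _ ≤ ∫ x, w * Real.exp (-T ^ 2 / (8 * σ ^ 2)) * Real.exp (-x ^ 2 / (8 * σ ^ 2)) :=
        setIntegral_le_integral hint (Eventually.of_forall fun x => by positivity)
    _ = w * √(Real.pi * (8 * σ ^ 2)) * Real.exp (-T ^ 2 / (8 * σ ^ 2)) := by
        rw [integral_const_mul, integral_gaussian_div]; ring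
    _ ≤ 1 / √σ * (6 * σ) * Real.exp (-T ^ 2 / (8 * σ ^ 2)) := by
        gcongr ?_ * ?_ * _
        · exact controlC_prefactor_le hσ
        · rw [Real.sqrt_le_left (by positivity)]
          nlinarith [Real.pi_le_four, sq_nonneg σ]
    _ = _ := by
        congr 1; field_simp; rw [Real.sq_sqrt hσ.le]

end Control

/-! ### The interaction picture -/

section Interaction

variable {𝔸 : Type*} [CStarAlgebra 𝔸] {a X p q : 𝔸} {σ α T : ℝ}

/-- The generator `-i α f(z) e^{iza} X e^{-iza}` of the evolution in the interaction picture,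
at complex time `z`. -/
def interactionGen (a X : 𝔸) (σ α : ℝ) (z : ℂ) : 𝔸 :=
  (-Complex.I * α * controlC σ z) • (propagator a z * X * propagator a (-z))

lemma differentiable_interactionGen : Differentiable ℂ (interactionGen a X σ α) := by
  have h1 := differentiable_controlC σ
  have h2 := differentiable_propagator a
  unfold interactionGen
  fun_prop

lemma continuous_interactionGen : Continuous fun s : ℝ => interactionGen a X σ α s :=
  differentiable_interactionGen.continuous.comp Complex.continuous_ofReal

lemma norm_interactionGen_ofReal_le (ha : IsSelfAdjoint a) (hσ : 0 < σ) (hα : 0 < α)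
    (hX : ‖X‖ ≤ 2) (x : ℝ) : ‖interactionGen a X σ α x‖ ≤ 2 * α * control σ x := by
  have h : ‖propagator a x * X * propagator a (-x)‖ = ‖X‖ := by
    have := norm_mul_propagator_ofReal ha (-x) (propagator a x * X)
    rw [Complex.ofReal_neg] at this
    rw [this, norm_propagator_ofReal_mul ha]
  have h0 := control_pos hσ x
  rw [interactionGen, norm_smul, h, controlC_ofReal]
  simp only [norm_mul, norm_neg, Complex.norm_I, one_mul, Complex.norm_real,
    Real.norm_of_nonneg hα.le, Real.norm_of_nonneg h0.le]
  calc α * control σ x * ‖X‖ ≤ α * control σ x * 2 := by gcongr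
    _ = _ := by ring

lemma conj_interactionGen (y : ℝ) (x : ℝ) :
    propagator a (-(y * Complex.I)) * interactionGen a X σ α (x + y * Complex.I) *
        propagator a (y * Complex.I) =
      (-Complex.I * α * controlC σ (x + y * Complex.I)) •
        (propagator a x * X * propagator a (-x)) := by
  rw [interactionGen, mul_smul_comm, smul_mul_assoc]
  congr 1
  have h1 : propagator a (x : ℂ) =
      propagator a (-(y * Complex.I)) * propagator a (x + y * Complex.I) := by
    rw [← propagator_add]; congr 1; ring
  have h2 : propagator a (-(x : ℂ)) =
      propagator a (-(x + y * Complex.I)) * propagator a (y * Complex.I) := by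
    rw [← propagator_add]; congr 1; ring
  rw [h1, h2]
  simp only [mul_assoc]

lemma exp_le_two_of_le_half {x : ℝ} (hx : x ≤ 1 / 2) : Real.exp x ≤ 2 := by
  rw [← Real.le_log_iff_exp_le two_pos]
  linarith [Real.log_two_gt_d9]

variable [Nontrivial 𝔸]

/-- The bound on the Dyson terms that ignores the gap. Its constant is that of
`norm_corner_gaussian_le`, for uniformity. -/
lemma norm_corner_crude (ha : IsSelfAdjoint a) (hσ : 0 < σ) (hα : 0 < α) (hX : ‖X‖ ≤ 2)
    (hT : 0 ≤ T) (hp : ‖p‖ ≤ 1) (hq : ‖q‖ ≤ 1) (n : ℕ) :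
    ‖q * dysonSeq (fun s : ℝ => interactionGen a X σ α s) (-T) n T * p‖ ≤
      (16 * α * √σ) ^ n / n.factorial := by
  have hc : Continuous fun s => 2 * α * control σ s := (continuous_control σ).const_mul _
  have h := norm_dysonSeq_le (t₀ := -T) (b := T) (k := fun s => 2 * α * control σ s)
    (κ := fun t => ∫ s in -T..t, 2 * α * control σ s)
    (continuous_interactionGen (a := a) (X := X) (σ := σ) (α := α))
    (fun s _ => norm_interactionGen_ofReal_le ha hσ hα hX s)
    (fun s => intervalIntegral.integral_hasDerivAt_right (hc.intervalIntegrable _ _)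
        (hc.stronglyMeasurableAtFilter _ _) hc.continuousAt) intervalIntegral.integral_same n
    (t := T) ⟨by linarith, le_rfl⟩
  have h1 : ∫ s in -T..T, 2 * α * control σ s ≤ 16 * α * √σ := by
    rw [intervalIntegral.integral_const_mul]
    have := intervalIntegral_control_le hσ T
    have hs := Real.sqrt_nonneg σ
    calc _ ≤ 2 * α * (4 * √σ) := by gcongr
      _ ≤ _ := by nlinarith [mul_nonneg hα.le hs]
  have h0 : 0 ≤ ∫ s in -T..T, 2 * α * control σ s :=
    intervalIntegral.integral_nonneg (by linarith) fun s _ =>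
      mul_nonneg (by positivity) (control_pos hσ s).le
  set D := dysonSeq (fun s : ℝ => interactionGen a X σ α s) (-T) n T
  calc _ ≤ ‖q‖ * ‖D‖ * ‖p‖ :=
        (norm_mul_le _ _).trans (mul_le_mul_of_nonneg_right (norm_mul_le _ _) (norm_nonneg _))
    _ ≤ 1 * ‖D‖ * 1 := by gcongr
    _ ≤ _ := by
      rw [one_mul, mul_one]
      refine h.trans ?_
      gcongr

/-- The corner `q Dₙ p` of the Dyson terms, for `p` in the kernel of `a`: it is governed by
`‖q e^{-σa}‖`, which is exponentially small if `a` has a gap on the range of `q`, and by the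
part of the Gaussian outside `[-T, T]`. -/
lemma norm_corner_gaussian_le (ha : IsSelfAdjoint a) (hσ : 0 < σ) (hα : 0 < α) (hX : ‖X‖ ≤ 2)
    (hT : 0 ≤ T) (hap : a * p = 0) (hp : ‖p‖ ≤ 1) (hq : ‖q‖ ≤ 1) (n : ℕ) :
    ‖q * dysonSeq (fun s : ℝ => interactionGen a X σ α s) (-T) (n + 1) T * p‖ ≤
      (‖q * propagator a (σ * Complex.I)‖ + Real.exp (-T ^ 2 / (8 * σ ^ 2))) *
        ((16 * α * √σ) ^ (n + 1) / (n + 1).factorial) := by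
  have hs := Real.sqrt_nonneg σ
  -- The imaginary shift is by `σ`, so that `|f(x + iy)| ≤ e^{1/4} f(x) ≤ 2 f(x)` on the strip.
  have hctrl : ∀ x : ℝ, ∀ y ∈ Icc 0 σ, ‖-Complex.I * α * controlC σ (x + y * Complex.I)‖ ≤
      2 * α * control σ x := fun x y hy => by
    have h0 := control_pos hσ x
    rw [norm_mul, norm_controlC hσ, norm_mul, norm_neg, Complex.norm_I, one_mul,
      Complex.norm_real, Real.norm_of_nonneg hα.le]
    have : Real.exp (y ^ 2 / (4 * σ ^ 2)) ≤ 2 := by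
      refine exp_le_two_of_le_half ?_
      rw [div_le_div_iff₀ (by positivity) (by positivity)]
      nlinarith [hy.1, hy.2]
    calc _ ≤ α * (control σ x * 2) := by gcongr
      _ = _ := by ring
  obtain ⟨M, hM⟩ := (isCompact_Icc (a := (0 : ℝ)) (b := σ)).exists_bound_of_continuousOn
    (f := fun y : ℝ => ‖propagator a (y * Complex.I)‖ * ‖propagator a (-(y * Complex.I))‖)
    (by
      have := (differentiable_propagator a).continuous
      fun_prop)
  have hM0 : 0 ≤ M := (norm_nonneg _).trans (hM 0 ⟨le_rfl, hσ.le⟩)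
  have hprop : ∀ x : ℝ, ‖propagator a (x : ℂ)‖ = 1 := fun x => by
    simpa using norm_propagator_ofReal_mul ha x 1
  have hint : ∀ c : ℝ, 0 ≤ c → ∀ R, ∫ x in -R..R, c * control σ x ≤ c * (4 * √σ) :=
    fun c hc R => by
      rw [intervalIntegral.integral_const_mul]
      exact mul_le_mul_of_nonneg_left (intervalIntegral_control_le hσ R) hc
  have hlim := (tendsto_control hσ).const_mul (4 * α * M)
  rw [mul_zero, cocompact_eq_atBot_atTop, tendsto_sup] at hlim
  set I0 := ∫ x, control σ x with hI0
  set IT := ∫ x in -T..T, control σ x with hIT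
  have hI0' : I0 ≤ 4 * √σ := integral_control_le hσ
  have htail : I0 - IT ≤ 6 * √σ * Real.exp (-T ^ 2 / (8 * σ ^ 2)) :=
    integral_control_tail_le hσ hT
  have hIR := intervalIntegral_control_le_integral hσ
  have hIT0 : 0 ≤ IT :=
    intervalIntegral.integral_nonneg (by linarith) fun x _ => (control_pos hσ x).le
  have key := norm_corner_le (K := interactionGen a X σ α) (h := fun x => 4 * α * M * control σ x)
    (H := 4 * α * M * (1 / √σ)) (B := 4 * α * M * (4 * √σ)) (η := σ)
    (u := propagator a (σ * Complex.I)) (v := propagator a (-(σ * Complex.I))) (p := p) (q := q)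
    (k := fun x => 4 * α * control σ x) (κ := 4 * α * (4 * √σ))
    (k₀ := fun x => 2 * α * control σ x) (κ₀ := 2 * α * I0) (T := T)
    differentiable_interactionGen hσ.le ((continuous_control σ).const_mul _)
    (fun x y hy => ?_) (fun x => ?_) (hint _ (by positivity)) hlim.2 hlim.1 (by simp) (by simp)
    (propagator_mul_of_mul_eq_zero hap _) hp hq ((continuous_control σ).const_mul _)
    (fun x => ?_) (hint _ (by positivity)) ((continuous_control σ).const_mul _)
    (norm_interactionGen_ofReal_le ha hσ hα hX) (fun R => ?_) hT (n + 1)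
  · refine key.trans ?_
    rw [intervalIntegral.integral_const_mul, ← hIT, mul_div_assoc']
    gcongr
    rw [add_mul]
    have hx : 4 * α * (4 * √σ) = 16 * α * √σ := by ring
    rw [hx]
    have hIT' : IT ≤ I0 := hIR T
    have hpow : (2 * α * I0) ^ (n + 1) - (2 * α * IT) ^ (n + 1) ≤
        (2 * α * I0 - 2 * α * IT) * ((n + 1 : ℕ) * (2 * α * I0) ^ n) := by
      have h1 := abs_pow_sub_pow_le (2 * α * I0) (2 * α * IT) (n + 1)
      have h2 : 2 * α * IT ≤ 2 * α * I0 := by gcongr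
      have h3 : 0 ≤ 2 * α * IT := by positivity
      rw [abs_of_nonneg (sub_nonneg.2 h2), abs_of_nonneg h3, abs_of_nonneg (h3.trans h2),
        max_eq_left h2, Nat.add_sub_cancel] at h1
      exact (le_abs_self _).trans (h1.trans (mul_assoc _ _ _).le)
    -- The derivative of the power costs a factor `n + 1`, which doubling the base absorbs.
    have hn : ((n + 1 : ℕ) : ℝ) ≤ 2 ^ n := by
      exact_mod_cast Nat.lt_two_pow_self
    gcongr
    calc _ ≤ _ := hpow
      _ ≤ (12 * α * √σ * Real.exp (-T ^ 2 / (8 * σ ^ 2))) * (2 ^ n * (8 * α * √σ) ^ n) := by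
        have h1 : 2 * α * I0 - 2 * α * IT ≤ 12 * α * √σ * Real.exp (-T ^ 2 / (8 * σ ^ 2)) := by
          rw [← mul_sub]
          calc _ ≤ 2 * α * (6 * √σ * Real.exp (-T ^ 2 / (8 * σ ^ 2))) := by gcongr
            _ = _ := by ring
        have h2 : 2 * α * I0 ≤ 8 * α * √σ := by
          calc _ ≤ 2 * α * (4 * √σ) := by gcongr
            _ = _ := by ring
        have h3 : 0 ≤ I0 := hIT0.trans hIT'
        gcongr
      _ = Real.exp (-T ^ 2 / (8 * σ ^ 2)) * (12 * α * √σ * (16 * α * √σ) ^ n) := by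
        rw [← mul_pow]; ring
      _ ≤ Real.exp (-T ^ 2 / (8 * σ ^ 2)) * (16 * α * √σ * (16 * α * √σ) ^ n) := by
        gcongr; norm_num
      _ = _ := by rw [pow_succ]; ring
  · have h1 : ‖propagator a (x + y * Complex.I) * X * propagator a (-(x + y * Complex.I))‖ ≤
        M * 2 := by
      have h2 := hM y hy
      rw [Real.norm_of_nonneg (by positivity)] at h2
      rw [neg_add, propagator_add, propagator_add, ← Complex.ofReal_neg]
      calc _ ≤ ‖propagator a x‖ * ‖propagator a (y * Complex.I)‖ * ‖X‖ *
            (‖propagator a (-x : ℝ)‖ * ‖propagator a (-(y * Complex.I))‖) := by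
            refine (norm_mul_le _ _).trans (mul_le_mul ?_ (norm_mul_le _ _) (norm_nonneg _)
              (by positivity))
            refine (norm_mul_le _ _).trans (mul_le_mul_of_nonneg_right (norm_mul_le _ _)
              (norm_nonneg _))
        _ = ‖propagator a (y * Complex.I)‖ * ‖propagator a (-(y * Complex.I))‖ * ‖X‖ := by
            rw [hprop, hprop]; ring
        _ ≤ M * 2 := by gcongr
    rw [interactionGen, norm_smul]
    have h0 := control_pos hσ x
    calc _ ≤ 2 * α * control σ x * (M * 2) :=
          mul_le_mul (hctrl x y hy) h1 (norm_nonneg _) (by positivity)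
      _ = _ := by ring
  · gcongr
    exact control_le hσ x
  · rw [conj_interactionGen, norm_smul]
    have h : ‖propagator a (x : ℂ) * X * propagator a (-(x : ℂ))‖ ≤ 2 := by
      have := norm_mul_propagator_ofReal ha (-x) (propagator a x * X)
      rw [Complex.ofReal_neg] at this
      rw [this, norm_propagator_ofReal_mul ha]
      exact hX
    calc _ ≤ 2 * α * control σ x * 2 :=
          mul_le_mul (hctrl x σ ⟨hσ.le, le_rfl⟩) h (norm_nonneg _)
            (mul_nonneg (by positivity) (control_pos hσ x).le)
      _ = _ := by ring
  · rw [intervalIntegral.integral_const_mul]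
    exact mul_le_mul_of_nonneg_left (hIR R) (by positivity)

end Interaction

section Evolution

variable {𝔸 : Type*} [CStarAlgebra 𝔸] {a X p q : 𝔸} {σ α T e : ℝ} {U : ℝ → 𝔸}

/-- The evolution generated by a skew-adjoint generator is isometric. -/
lemma star_mul_self_of_skewAdjoint {L : ℝ → 𝔸} {t₀ : ℝ} (hU0 : U t₀ = 1)
    (hU : ∀ t, HasDerivAt U (L t * U t) t) (hL : ∀ t, star (L t) = -L t) (t : ℝ) :
    star (U t) * U t = 1 := by
  have hd : ∀ t, HasDerivAt (fun t => star (U t) * U t) 0 t := fun t => by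
    refine ((hU t).star.mul (hU t)).congr_deriv ?_
    rw [star_mul, hL, mul_neg, neg_mul, mul_assoc, neg_add_cancel]
  have := is_const_of_deriv_eq_zero (fun t => (hd t).differentiableAt) (fun t => (hd t).deriv) t t₀
  simpa [hU0] using this

/-- If a series has corner terms `q Dₙ p` which vanish for `n < j` and are dominated by
`δ xⁿ / n!` from `j` on, then the corner of its sum is at most `δ x^j e^x`. -/
lemma norm_corner_sum_le {D : ℕ → 𝔸} {V : 𝔸} (hV : HasSum D V) {j : ℕ} {δ x : ℝ} (hδ : 0 ≤ δ)
    (hx : 0 ≤ x) (hz : ∀ n < j, q * D n * p = 0)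
    (hb : ∀ n, j ≤ n → ‖q * D n * p‖ ≤ δ * (x ^ n / n.factorial)) :
    ‖q * V * p‖ ≤ δ * (x ^ j * Real.exp x) := by
  have h1 : HasSum (fun n => q * D n * p) (q * V * p) := (hV.mul_left q).mul_right p
  have h2 : HasSum (fun n => q * D (n + j) * p) (q * V * p) := by
    refine (hasSum_nat_add_iff (f := fun n => q * D n * p) j).2 ?_
    rwa [Finset.sum_eq_zero fun n hn => hz n (Finset.mem_range.1 hn), add_zero]
  have h3 : HasSum (fun n : ℕ => δ * (x ^ j * (x ^ n / n.factorial))) (δ * (x ^ j * Real.exp x)) := by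
    rw [Real.exp_eq_exp_ℝ]
    exact ((NormedSpace.expSeries_div_hasSum_exp x).mul_left _).mul_left _
  rw [← h2.tsum_eq]
  refine tsum_of_norm_bounded h3 fun n => (hb _ (Nat.le_add_left _ _)).trans ?_
  rw [pow_add, mul_comm (x ^ n), mul_div_assoc]
  gcongr
  exact Nat.le_add_right _ _

/-- The Schrödinger equation of the joint evolution: the free Hamiltonian is `a + e`, the
interaction is `α f(t) X`. -/
def IsEvolution (a X : 𝔸) (e σ α T : ℝ) (U : ℝ → 𝔸) : Prop :=
  U (-T) = 1 ∧ ∀ t : ℝ, HasDerivAt U ((-Complex.I • (a + (e : ℂ) • (1 : 𝔸)) +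
    (-Complex.I * α * control σ t) • X) * U t) t

/-- In the interaction picture the evolution is, up to a phase, the sum of the Dyson series of
`interactionGen`. -/
lemma IsEvolution.hasSum [Nontrivial 𝔸] (hU : IsEvolution a X e σ α T U) (hT : 0 ≤ T) :
    HasSum (fun n => dysonSeq (fun s : ℝ => interactionGen a X σ α s) (-T) n T)
      (Complex.exp ((T + T : ℝ) * (Complex.I * e)) •
        (propagator a T * U T * propagator a T)) := by
  let V : ℝ → 𝔸 := fun t => Complex.exp ((t + T : ℝ) * (Complex.I * e)) •
    (propagator a t * U t * propagator a T)
  refine hasSum_dysonSeq (V := V) continuous_interactionGen ?_ (fun t => ?_) (by linarith)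
  · simp [V, hU.1]
  · have h1 : HasDerivAt (fun t : ℝ => Complex.exp ((t + T : ℝ) * (Complex.I * e)))
        (Complex.exp ((t + T : ℝ) * (Complex.I * e)) * (Complex.I * e)) t := by
      have h0 : HasDerivAt (fun t : ℝ => ((t + T : ℝ) : ℂ) * (Complex.I * e)) (Complex.I * e) t := by
        have := ((Complex.ofRealCLM.hasDerivAt (x := t)).add_const (T : ℂ)).mul_const
          (Complex.I * e)
        simpa using this
      exact h0.cexp
    have h2 : HasDerivAt (fun t : ℝ => propagator a t) (propagator a t * (Complex.I • a)) t := by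
      simpa using! (hasDerivAt_propagator a t).scomp t Complex.ofRealCLM.hasDerivAt
    have h3 := h1.smul ((h2.mul (hU.2 t)).mul_const (propagator a T))
    refine h3.congr_deriv ?_
    simp only [V, interactionGen, controlC_ofReal]
    have h4 : propagator a (-(t : ℂ)) * propagator a t = 1 := propagator_neg_mul a t
    have h5 : (-Complex.I * α * control σ t) • (propagator a t * X * propagator a (-(t : ℂ))) *
        Complex.exp ((t + T : ℝ) * (Complex.I * e)) • (propagator a t * U t * propagator a T) =
        Complex.exp ((t + T : ℝ) * (Complex.I * e)) • (-Complex.I * α * control σ t) •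
          (propagator a t * X * (propagator a (-(t : ℂ)) * propagator a t) * U t *
            propagator a T) := by
      simp only [smul_mul_assoc, mul_smul_comm, mul_assoc]
    rw [h5, h4]
    simp only [Pi.mul_apply, add_mul, mul_add, smul_mul_assoc, mul_smul_comm, smul_add, smul_smul,
      one_mul, mul_one, neg_smul, mul_assoc, neg_mul, mul_neg, smul_neg]
    module

lemma norm_corner_interaction_eq (ha : IsSelfAdjoint a) (hap : a * p = 0) (hqa : Commute q a)
    (u : 𝔸) :
    ‖q * (Complex.exp ((T + T : ℝ) * (Complex.I * e)) •
        (propagator a T * u * propagator a T)) * p‖ = ‖q * u * p‖ := by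
  have h1 : q * (Complex.exp ((T + T : ℝ) * (Complex.I * e)) •
        (propagator a T * u * propagator a T)) * p =
      Complex.exp ((T + T : ℝ) * (Complex.I * e)) • (propagator a T * (q * u * p)) := by
    rw [mul_smul_comm, smul_mul_assoc]
    congr 1
    calc _ = q * propagator a T * u * (propagator a T * p) := by simp only [mul_assoc]
      _ = _ := by
        rw [propagator_mul_of_mul_eq_zero hap, (commute_propagator hqa (T : ℂ)).eq]
        simp only [mul_assoc]
  rw [h1, norm_smul, norm_propagator_ofReal_mul ha, Complex.norm_exp]
  simp

lemma corner_dysonSeq_one_eq_zero (hap : a * p = 0) (hqa : Commute q a) (hqX : q * X * p = 0)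
    (t₀ t : ℝ) :
    q * dysonSeq (fun s : ℝ => interactionGen a X σ α s) t₀ 1 t * p = 0 := by
  have hd : ∀ t, HasDerivAt (fun t =>
      q * dysonSeq (fun s : ℝ => interactionGen a X σ α s) t₀ 1 t * p) 0 t := fun t => by
    refine (((hasDerivAt_dysonSeq continuous_interactionGen 0 t).const_mul q).mul_const
      p).congr_deriv ?_
    rw [dysonSeq_zero, mul_one, interactionGen, mul_smul_comm, smul_mul_assoc]
    have : q * (propagator a t * X * propagator a (-(t : ℂ))) * p = 0 := by
      calc _ = q * propagator a t * X * (propagator a (-(t : ℂ)) * p) := by simp only [mul_assoc]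
        _ = propagator a t * (q * X * p) := by
          rw [propagator_mul_of_mul_eq_zero hap, (commute_propagator hqa (t : ℂ)).eq]
          simp only [mul_assoc]
        _ = 0 := by rw [hqX, mul_zero]
    rw [this, smul_zero]
  have := is_const_of_deriv_eq_zero (fun t => (hd t).differentiableAt) (fun t => (hd t).deriv) t t₀
  rw [this, dysonSeq_succ_self, mul_zero, zero_mul]

variable [Nontrivial 𝔸]

/-- Leakage out of `p` into any orthogonal sector is of first order in the coupling. -/
lemma IsEvolution.norm_corner_le (hU : IsEvolution a X e σ α T U) (ha : IsSelfAdjoint a)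
    (hσ : 0 < σ) (hα : 0 < α) (hX : ‖X‖ ≤ 2) (hT : 0 ≤ T) (hap : a * p = 0) (hp : ‖p‖ ≤ 1)
    (hq : ‖q‖ ≤ 1) (hqa : Commute q a) (hqp : q * p = 0) :
    ‖q * U T * p‖ ≤ 16 * α * √σ * Real.exp (16 * α * √σ) := by
  rw [← norm_corner_interaction_eq (e := e) ha hap hqa]
  have := norm_corner_sum_le (q := q) (p := p) (hU.hasSum hT) (j := 1) (δ := 1)
    (x := 16 * α * √σ) zero_le_one (by positivity) (fun n hn => ?_) (fun n _ => ?_)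
  · simpa using this
  · obtain rfl : n = 0 := by omega
    simpa using hqp
  · rw [one_mul]
    exact norm_corner_crude ha hσ hα hX hT hp hq n

/-- Leakage out of `p` into a sector `q` across the gap: it is of order `j` in the coupling, with the
small prefactor `δ`. Here `j = 2` is allowed if the coupling does not lead from `p` to `q`
directly, so that the first-order term vanishes. -/
lemma IsEvolution.norm_gapped_corner_le (hU : IsEvolution a X e σ α T U) (ha : IsSelfAdjoint a)
    (hσ : 0 < σ) (hα : 0 < α) (hX : ‖X‖ ≤ 2) (hT : 0 ≤ T) (hap : a * p = 0) (hp : ‖p‖ ≤ 1)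
    (hq : ‖q‖ ≤ 1) (hqa : Commute q a) (hqp : q * p = 0) {δ : ℝ}
    (hδ : ‖q * propagator a (σ * Complex.I)‖ + Real.exp (-T ^ 2 / (8 * σ ^ 2)) ≤ δ)
    {j : ℕ} (hj1 : 1 ≤ j) (hj2 : j ≤ 2) (hqX : j = 2 → q * X * p = 0) :
    ‖q * U T * p‖ ≤ δ * ((16 * α * √σ) ^ j * Real.exp (16 * α * √σ)) := by
  have hδ0 : 0 ≤ δ := le_trans (by positivity) hδ
  rw [← norm_corner_interaction_eq (e := e) ha hap hqa]
  refine norm_corner_sum_le (hU.hasSum hT) hδ0 (by positivity) (fun n hn => ?_) (fun n hn => ?_)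
  · rcases Nat.eq_zero_or_pos n with rfl | hn0
    · simpa using hqp
    · obtain rfl : n = 1 := by omega
      exact corner_dysonSeq_one_eq_zero hap hqa (hqX (by omega)) _ _
  · obtain ⟨n, rfl⟩ := Nat.exists_eq_succ_of_ne_zero (show n ≠ 0 by omega)
    exact (norm_corner_gaussian_le ha hσ hα hX hT hap hp hq n).trans (by gcongr)

end Evolution

/-! ### The trace norm of Hermitian matrices -/

section TraceNorm

variable {m : Type*} [Fintype m] [DecidableEq m]

lemma norm_dotProduct_mulVec_le (S : Matrix m m ℂ) (x : m → ℂ) :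
    ‖star x ⬝ᵥ S *ᵥ x‖ ≤ ‖S‖ * (star x ⬝ᵥ x).re := by
  let y : EuclideanSpace ℂ m := WithLp.toLp 2 x
  have h1 : star x ⬝ᵥ S *ᵥ x = inner ℂ y (WithLp.toLp 2 (S *ᵥ x)) := by
    rw [EuclideanSpace.inner_eq_star_dotProduct, dotProduct_comm]
  have h2 : (star x ⬝ᵥ x).re = ‖y‖ ^ 2 := by
    rw [← inner_self_eq_norm_sq (𝕜 := ℂ), EuclideanSpace.inner_eq_star_dotProduct, dotProduct_comm]
    rfl
  rw [h1, h2]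
  calc _ ≤ ‖y‖ * ‖WithLp.toLp 2 (S *ᵥ x)‖ := norm_inner_le_norm _ _
    _ ≤ ‖y‖ * (‖S‖ * ‖y‖) := by gcongr; exact Matrix.l2_opNorm_mulVec S y
    _ = _ := by ring

/-- Positive semidefinite matrices have trace norm equal to their trace: this is the bound by
duality with the operator norm. -/
lemma norm_trace_mul_le {M : Matrix m m ℂ} (hM : M.PosSemidef) (S : Matrix m m ℂ) :
    ‖(S * M).trace‖ ≤ ‖S‖ * M.trace.re := by
  obtain ⟨B, rfl⟩ := CStarAlgebra.nonneg_iff_eq_star_mul_self.1 (Matrix.nonneg_iff_posSemidef.2 hM)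
  have hx : ∀ (S : Matrix m m ℂ), (S * (star B * B)).trace =
      ∑ i, star (fun j => star (B i j)) ⬝ᵥ S *ᵥ (fun j => star (B i j)) := fun S => by
    rw [← mul_assoc, Matrix.trace_mul_comm, ← mul_assoc, mul_assoc, Matrix.trace]
    refine Finset.sum_congr rfl fun i _ => ?_
    simp [Matrix.mul_apply, dotProduct, Matrix.mulVec]
  have h1 := hx 1
  rw [one_mul] at h1
  rw [hx, h1, Complex.re_sum, Finset.mul_sum]
  refine (norm_sum_le _ _).trans (Finset.sum_le_sum fun i _ => ?_)
  simpa using norm_dotProduct_mulVec_le S fun j => star (B i j)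

lemma exists_posSemidef_decomposition {Y : Matrix m m ℂ} (hY : Y.IsHermitian) :
    ∃ A B : Matrix m m ℂ, A.PosSemidef ∧ B.PosSemidef ∧ Y = A - B ∧
      traceNorm Y = A.trace.re + B.trace.re := by
  have hs : IsSelfAdjoint Y := hY
  refine ⟨Y⁺, Y⁻, Matrix.nonneg_iff_posSemidef.1 (CFC.posPart_nonneg Y),
    Matrix.nonneg_iff_posSemidef.1 (CFC.negPart_nonneg Y), (CFC.posPart_sub_negPart Y hs).symm, ?_⟩
  rw [traceNorm, ← CFC.posPart_add_negPart Y hs, Matrix.trace_add, Complex.add_re]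

lemma re_trace_mul_le_traceNorm {Y : Matrix m m ℂ} (hY : Y.IsHermitian) {S : Matrix m m ℂ}
    (hS : ‖S‖ ≤ 1) : (S * Y).trace.re ≤ traceNorm Y := by
  obtain ⟨A, B, hA, hB, rfl, h⟩ := exists_posSemidef_decomposition hY
  have htr : ∀ {M : Matrix m m ℂ}, M.PosSemidef → |(S * M).trace.re| ≤ M.trace.re := fun hM => by
    refine (Complex.abs_re_le_norm _).trans ((norm_trace_mul_le hM S).trans ?_)
    have := (Complex.le_def.1 hM.trace_nonneg).1
    exact mul_le_of_le_one_left this hS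
  rw [h, mul_sub, Matrix.trace_sub, Complex.sub_re]
  have h1 := abs_le.1 (htr hA)
  have h2 := abs_le.1 (htr hB)
  linarith

/-- The trace norm of a Hermitian matrix is attained by the functional of its sign. -/
lemma exists_traceNorm_eq {Y : Matrix m m ℂ} (hY : Y.IsHermitian) :
    ∃ S : Matrix m m ℂ, ‖S‖ ≤ 1 ∧ traceNorm Y = (S * Y).trace.re := by
  have hs : IsSelfAdjoint Y := hY
  let s : ℝ → ℝ := fun x => SignType.sign x
  have hc : ContinuousOn s (spectrum ℝ Y) := Y.finite_real_spectrum.continuousOn _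
  refine ⟨cfc s Y, norm_cfc_le zero_le_one fun x _ => ?_, ?_⟩
  · rcases lt_trichotomy x 0 with h | h | h <;> simp [s, h]
  · rw [traceNorm, CFC.abs_eq_cfc_norm Y hs]
    congr 2
    conv_rhs => rw [← cfc_id ℝ Y hs, cfc_id ℝ Y hs]
    nth_rewrite 3 [← cfc_id ℝ Y hs]
    rw [← cfc_mul s id Y hc]
    refine cfc_congr fun x _ => ?_
    simp [s, sign_mul_self]

lemma traceNorm_le_of_forall {Y : Matrix m m ℂ} (hY : Y.IsHermitian) {c : ℝ}
    (h : ∀ S : Matrix m m ℂ, ‖S‖ ≤ 1 → (S * Y).trace.re ≤ c) : traceNorm Y ≤ c := by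
  obtain ⟨S, hS, hY'⟩ := exists_traceNorm_eq hY
  exact hY'.trans_le (h S hS)

lemma traceNorm_add_le {Y Z : Matrix m m ℂ} (hY : Y.IsHermitian) (hZ : Z.IsHermitian) :
    traceNorm (Y + Z) ≤ traceNorm Y + traceNorm Z :=
  traceNorm_le_of_forall (hY.add hZ) fun S hS => by
    rw [mul_add, Matrix.trace_add, Complex.add_re]
    exact add_le_add (re_trace_mul_le_traceNorm hY hS) (re_trace_mul_le_traceNorm hZ hS)

@[simp] lemma traceNorm_zero : traceNorm (0 : Matrix m m ℂ) = 0 := by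
  simp [traceNorm]

end TraceNorm

/-! ### Projections, partial traces and exponentials -/

lemma norm_le_one_of_isSelfAdjoint_of_idempotent {𝔸 : Type*} [CStarAlgebra 𝔸] {q : 𝔸}
    (h1 : IsSelfAdjoint q) (h2 : q * q = q) : ‖q‖ ≤ 1 := by
  have h := CStarRing.norm_star_mul_self (x := q)
  rw [h1.star_eq, h2] at h
  nlinarith [norm_nonneg q, sq_nonneg (‖q‖ - 1)]

lemma norm_exp_le_of_le_algebraMap {𝔸 : Type*} [CStarAlgebra 𝔸] [PartialOrder 𝔸]
    [StarOrderedRing 𝔸] {b : 𝔸} (hs : IsSelfAdjoint b) {c : ℝ} (hb : b ≤ algebraMap ℝ 𝔸 c) :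
    ‖NormedSpace.exp b‖ ≤ Real.exp c := by
  rw [← CFC.real_exp_eq_normedSpace_exp hs]
  refine norm_cfc_le (Real.exp_pos c).le fun x hx => ?_
  rw [Real.norm_of_nonneg (Real.exp_pos x).le, Real.exp_le_exp]
  exact (le_algebraMap_iff_spectrum_le hs).1 hb x hx

/-- If `q` commutes with `a` and `b`, and `a` and `b` agree on the range of `q`, then so do their
exponentials. -/
lemma mul_exp_eq_mul_exp {𝔸 : Type*} [CStarAlgebra 𝔸] {q a b : 𝔸} (hb : Commute q b)
    (h : q * a = q * b) : q * NormedSpace.exp a = q * NormedSpace.exp b := by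
  have hpow : ∀ n : ℕ, q * a ^ n = q * b ^ n := fun n => by
    induction n with
    | zero => simp
    | succ n ih => rw [pow_succ', ← mul_assoc, h, hb.eq, mul_assoc, ih, ← mul_assoc, ← hb.eq,
        mul_assoc, ← pow_succ']
  have h1 := (NormedSpace.exp_series_hasSum_exp' (𝕂 := ℂ) a).mul_left q
  have h2 := (NormedSpace.exp_series_hasSum_exp' (𝕂 := ℂ) b).mul_left q
  simp only [mul_smul_comm, hpow] at h1 h2
  exact h1.unique h2

section Kronecker

variable {m e : Type*} [Fintype m] [DecidableEq m] [Fintype e] [DecidableEq e]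

lemma norm_kronecker_one_le (A : Matrix m m ℂ) : ‖A ⊗ₖ (1 : Matrix e e ℂ)‖ ≤ ‖A‖ := by
  let φ : Matrix m m ℂ →⋆ₐ[ℂ] Matrix (m × e) (m × e) ℂ :=
    { toFun := fun A => A ⊗ₖ (1 : Matrix e e ℂ)
      map_one' := Matrix.one_kronecker_one
      map_mul' := fun A B => by rw [← Matrix.mul_kronecker_mul, one_mul]
      map_zero' := Matrix.zero_kronecker _
      map_add' := fun A B => Matrix.add_kronecker _ _ _
      commutes' := fun r => by
        simp only [Algebra.algebraMap_eq_smul_one, Matrix.smul_kronecker, Matrix.one_kronecker_one]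
      map_star' := fun A => by
        simp only [Matrix.star_eq_conjTranspose, Matrix.conjTranspose_kronecker,
          Matrix.conjTranspose_one] }
  exact NonUnitalStarAlgHom.norm_apply_le φ A

lemma norm_one_kronecker_le (B : Matrix e e ℂ) : ‖(1 : Matrix m m ℂ) ⊗ₖ B‖ ≤ ‖B‖ := by
  let φ : Matrix e e ℂ →⋆ₐ[ℂ] Matrix (m × e) (m × e) ℂ :=
    { toFun := fun B => (1 : Matrix m m ℂ) ⊗ₖ B
      map_one' := Matrix.one_kronecker_one
      map_mul' := fun A B => by rw [← Matrix.mul_kronecker_mul, one_mul]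
      map_zero' := Matrix.kronecker_zero _
      map_add' := fun A B => Matrix.kronecker_add _ _ _
      commutes' := fun r => by
        simp only [Algebra.algebraMap_eq_smul_one, Matrix.kronecker_smul, Matrix.one_kronecker_one]
      map_star' := fun A => by
        simp only [Matrix.star_eq_conjTranspose, Matrix.conjTranspose_kronecker,
          Matrix.conjTranspose_one] }
  exact NonUnitalStarAlgHom.norm_apply_le φ B

lemma norm_kronecker_le (A : Matrix m m ℂ) (B : Matrix e e ℂ) : ‖A ⊗ₖ B‖ ≤ ‖A‖ * ‖B‖ := by
  have : A ⊗ₖ B = (A ⊗ₖ (1 : Matrix e e ℂ)) * ((1 : Matrix m m ℂ) ⊗ₖ B) := by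
    rw [← Matrix.mul_kronecker_mul, mul_one, one_mul]
  rw [this]
  refine (norm_mul_le _ _).trans ?_
  gcongr
  · exact norm_kronecker_one_le A
  · exact norm_one_kronecker_le B

lemma trace_mul_partialTrace {m e : Type*} [Fintype m] [Fintype e] [DecidableEq e]
    (S : Matrix m m ℂ) (M : Matrix (m × e) (m × e) ℂ) :
    (S * partialTrace M).trace = ((S ⊗ₖ (1 : Matrix e e ℂ)) * M).trace := by
  simp only [Matrix.trace, Matrix.diag_apply, Matrix.mul_apply, partialTrace, Matrix.of_apply,
    Fintype.sum_prod_type, Matrix.kroneckerMap_apply, Matrix.one_apply, mul_ite, mul_one, mul_zero,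
    ite_mul, zero_mul, Finset.sum_ite_eq, Finset.mem_univ, if_true, Finset.mul_sum]
  refine Finset.sum_congr rfl fun i _ => ?_
  rw [Finset.sum_comm]

end Kronecker

/-! ### The ground state of system and bath -/

section Ketbra

variable {m : Type*} {ψ : m → ℂ}

lemma isHermitian_ketbra (ψ : m → ℂ) : (ketbra ψ).IsHermitian := by
  simp [Matrix.IsHermitian, ketbra, Matrix.conjTranspose_vecMulVec]

variable [Fintype m]

lemma mul_ketbra (M : Matrix m m ℂ) : M * ketbra ψ = Matrix.vecMulVec (M *ᵥ ψ) (star ψ) := by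
  rw [ketbra, Matrix.mul_vecMulVec]

lemma ketbra_mul_mul_ketbra (S : Matrix m m ℂ) :
    ketbra ψ * S * ketbra ψ = (star ψ ⬝ᵥ S *ᵥ ψ) • ketbra ψ := by
  rw [mul_assoc, mul_ketbra, ketbra, Matrix.vecMulVec_mul_vecMulVec]
  ext i j
  simp [Matrix.vecMulVec_apply]
  ring

lemma ketbra_mul_self (h : star ψ ⬝ᵥ ψ = 1) : ketbra ψ * ketbra ψ = ketbra ψ := by
  classical
  simpa [h] using ketbra_mul_mul_ketbra (ψ := ψ) 1

lemma trace_mul_ketbra (S : Matrix m m ℂ) : (S * ketbra ψ).trace = star ψ ⬝ᵥ S *ᵥ ψ := by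
  rw [mul_ketbra, Matrix.trace_vecMulVec, dotProduct_comm]

lemma isDensity_ketbra (h : star ψ ⬝ᵥ ψ = 1) : IsDensity (ketbra ψ) := by
  classical
  refine ⟨Matrix.posSemidef_vecMulVec_self_star ψ, ?_⟩
  simpa [h] using trace_mul_ketbra (ψ := ψ) 1

end Ketbra

section Gap

variable {N : ℕ} {H : Matrix (Fin N) (Fin N) ℂ} {Δ : ℝ} {ψ₀ : Fin N → ℂ}

lemma HasGappedGroundState.gap_le_two_mul_norm (h : HasGappedGroundState H Δ ψ₀) :
    Δ ≤ 2 * ‖H‖ := by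
  obtain ⟨E₀, h0, ⟨φ, hφ, -, h1⟩, -⟩ := h.gap
  have hev : ∀ (E : ℝ) (v : Fin N → ℂ), v ≠ 0 → H *ᵥ v = (E : ℂ) • v → |E| ≤ ‖H‖ := by
    intro E v hv hE
    have h2 := Matrix.l2_opNorm_mulVec H (WithLp.toLp 2 v)
    have hv' : 0 < ‖(WithLp.toLp 2 v : EuclideanSpace ℂ (Fin N))‖ := by
      rw [norm_pos_iff]; simpa using hv
    have h3 : (EuclideanSpace.equiv (Fin N) ℂ).symm (H *ᵥ v) =
        (E : ℂ) • (WithLp.toLp 2 v : EuclideanSpace ℂ (Fin N)) := by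
      rw [hE]; rfl
    change ‖(EuclideanSpace.equiv (Fin N) ℂ).symm (H *ᵥ v)‖ ≤ _ at h2
    rw [h3, norm_smul, Complex.norm_real, Real.norm_eq_abs] at h2
    exact le_of_mul_le_mul_right h2 hv'
  have hψ : ψ₀ ≠ 0 := by
    rintro rfl
    simpa using h.unit
  have h2 := abs_le.1 (hev E₀ ψ₀ hψ h0)
  have h3 := abs_le.1 (hev _ φ hφ h1)
  linarith

/-- The gap as an operator inequality: `H - E₀ ≥ Δ (1 - |ψ₀⟩⟨ψ₀|)`. -/
lemma HasGappedGroundState.exists_posSemidef (h : HasGappedGroundState H Δ ψ₀) :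
    ∃ E₀ : ℝ, H * ketbra ψ₀ = (E₀ : ℂ) • ketbra ψ₀ ∧
      (H - (E₀ : ℂ) • (1 : Matrix (Fin N) (Fin N) ℂ) - (Δ : ℂ) • (1 - ketbra ψ₀)).PosSemidef := by
  obtain ⟨E₀, h0, -, hleast⟩ := h.gap
  have hHP : H * ketbra ψ₀ = (E₀ : ℂ) • ketbra ψ₀ := by
    rw [mul_ketbra, h0, Matrix.smul_vecMulVec, ketbra]
  refine ⟨E₀, hHP, ?_⟩
  set M := H - (E₀ : ℂ) • (1 : Matrix (Fin N) (Fin N) ℂ) - (Δ : ℂ) • (1 - ketbra ψ₀) with hMdef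
  have hreal : ∀ (r : ℝ) {B : Matrix (Fin N) (Fin N) ℂ}, B.IsHermitian → ((r : ℂ) • B).IsHermitian :=
    fun r B hB => by
      rw [Matrix.IsHermitian, Matrix.conjTranspose_smul, hB.eq]; simp
  have hM : M.IsHermitian := (h.hermitian.sub (hreal _ Matrix.isHermitian_one)).sub
    (hreal _ (Matrix.isHermitian_one.sub (isHermitian_ketbra ψ₀)))
  have hPψ : ketbra ψ₀ *ᵥ ψ₀ = ψ₀ := by
    ext i
    simp [ketbra, Matrix.vecMulVec_mulVec, h.unit]
  have hMψ : M *ᵥ ψ₀ = 0 := by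
    simp [hMdef, Matrix.sub_mulVec, Matrix.smul_mulVec, h0, hPψ]
  rw [hM.posSemidef_iff_eigenvalues_nonneg]
  intro i
  change 0 ≤ hM.eigenvalues i
  by_contra hneg
  set μ := hM.eigenvalues i
  set v : Fin N → ℂ := (hM.eigenvectorBasis i).ofLp with hv
  have hMv : M *ᵥ v = (μ : ℂ) • v := hM.mulVec_eigenvectorBasis i
  have hμ : (μ : ℂ) ≠ 0 := by
    have : μ ≠ 0 := fun h => hneg h.ge
    exact_mod_cast this
  -- An eigenvector of `M` with nonzero eigenvalue is orthogonal to `ψ₀`, which `M` annihilates.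
  have horth : star ψ₀ ⬝ᵥ v = 0 := by
    have h1 : star ψ₀ ⬝ᵥ M *ᵥ v = 0 := by
      rw [Matrix.dotProduct_mulVec]
      have : star ψ₀ ᵥ* M = star (M *ᵥ ψ₀) := by
        rw [Matrix.star_mulVec, hM.eq]
      rw [this, hMψ]; simp
    rw [hMv, dotProduct_smul, smul_eq_mul] at h1
    exact (mul_eq_zero.1 h1).resolve_left hμ
  have hPv : ketbra ψ₀ *ᵥ v = 0 := by
    ext i
    simp [ketbra, Matrix.vecMulVec_mulVec, horth]
  have hHv : H *ᵥ v = ((E₀ + Δ + μ : ℝ) : ℂ) • v := by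
    have h1 : H = M + (E₀ : ℂ) • (1 : Matrix (Fin N) (Fin N) ℂ) + (Δ : ℂ) • (1 - ketbra ψ₀) := by
      rw [hMdef]; abel
    rw [h1]
    simp only [Matrix.add_mulVec, hMv, Matrix.smul_mulVec, Matrix.one_mulVec, Matrix.sub_mulVec,
      hPv, sub_zero]
    push_cast
    module
  have hv0 : v ≠ 0 := by
    have := hM.eigenvectorBasis.toBasis.ne_zero i
    simpa [hv] using this
  have := hleast ⟨v, hv0, horth, hHv⟩
  linarith

end Gap

section Bath

lemma isHermitian_bathGround (ω : ℝ) : (bathGround ω).IsHermitian := by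
  unfold bathGround
  split_ifs <;> (ext i j; fin_cases i <;> fin_cases j <;> simp)

lemma bathGround_mul_self (ω : ℝ) : bathGround ω * bathGround ω = bathGround ω := by
  unfold bathGround
  split_ifs <;> (ext i j; fin_cases i <;> fin_cases j <;> simp)

lemma trace_bathGround (ω : ℝ) : (bathGround ω).trace = 1 := by
  unfold bathGround
  split_ifs <;> simp

lemma bathGround_mul_bathCoupling_mul_bathGround (ω : ℝ) :
    bathGround ω * bathCoupling * bathGround ω = 0 := by
  unfold bathGround bathCoupling
  split_ifs <;> (ext i j; fin_cases i <;> fin_cases j <;> simp)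

lemma bathGround_mul_bathCoupling_conjTranspose_mul_bathGround (ω : ℝ) :
    bathGround ω * bathCouplingᴴ * bathGround ω = 0 := by
  have := congrArg Matrix.conjTranspose (bathGround_mul_bathCoupling_mul_bathGround ω)
  simpa [Matrix.conjTranspose_mul, (isHermitian_bathGround ω).eq, mul_assoc] using this

lemma norm_bathCoupling_le : ‖bathCoupling‖ ≤ 1 := by
  have h := Matrix.l2_opNorm_conjTranspose_mul_self bathCoupling
  have h1 : bathCouplingᴴ * bathCoupling = bathGround 0 := by
    unfold bathGround bathCoupling
    ext i j; fin_cases i <;> fin_cases j <;> simp [Matrix.mul_apply]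
  have h2 : ‖bathGround 0‖ ≤ 1 :=
    norm_le_one_of_isSelfAdjoint_of_idempotent (isHermitian_bathGround 0) (bathGround_mul_self 0)
  rw [h1] at h
  nlinarith [norm_nonneg bathCoupling]

lemma isHermitian_bathHamiltonian (ω : ℝ) : (bathHamiltonian ω).IsHermitian := by
  unfold bathHamiltonian
  ext i j; fin_cases i <;> fin_cases j <;> simp

lemma bathHamiltonian_mul_bathGround (ω : ℝ) :
    bathHamiltonian ω * bathGround ω = ((-(|ω| / 2) : ℝ) : ℂ) • bathGround ω := by
  unfold bathHamiltonian bathGround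
  split_ifs with h
  · rw [abs_of_nonneg h]
    ext i j; fin_cases i <;> fin_cases j <;> simp [neg_div]
  · rw [abs_of_neg (not_le.1 h)]
    ext i j; fin_cases i <;> fin_cases j <;> simp [neg_div]

lemma posSemidef_bathHamiltonian_add (ω : ℝ) :
    (bathHamiltonian ω + ((|ω| / 2 : ℝ) : ℂ) • (1 : Matrix (Fin 2) (Fin 2) ℂ)).PosSemidef := by
  have h : bathHamiltonian ω + ((|ω| / 2 : ℝ) : ℂ) • (1 : Matrix (Fin 2) (Fin 2) ℂ) =
      Matrix.diagonal ![(((|ω| - ω) / 2 : ℝ) : ℂ), (((|ω| + ω) / 2 : ℝ) : ℂ)] := by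
    unfold bathHamiltonian
    ext i j; fin_cases i <;> fin_cases j <;> simp <;> ring
  rw [h, Matrix.posSemidef_diagonal_iff]
  intro i
  fin_cases i
  · exact Complex.zero_le_real.2 (div_nonneg (sub_nonneg.2 (le_abs_self ω)) zero_le_two)
  · exact Complex.zero_le_real.2 (div_nonneg (by linarith [neg_abs_le ω]) zero_le_two)

end Bath

/-! ### From leakage to the reduced state -/

section Leakage

/-- The block `q Z q'` of an observable, in the state `U p U†`, is bounded by the product of the
amplitudes that lead from `p` to `q` and from `p` to `q'`. -/
lemma norm_trace_leakage_le {n : Type*} [Fintype n] [DecidableEq n] {p U q q' Z : Matrix n n ℂ}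
    (hp : p.PosSemidef) (hp2 : p * p = p) (htr : p.trace = 1) (hq : q.IsHermitian) {c c' : ℝ}
    (h : ‖q * U * p‖ ≤ c) (h' : ‖q' * U * p‖ ≤ c') (hZ : ‖Z‖ ≤ 1) :
    ‖(Uᴴ * (q * Z * q') * U * p).trace‖ ≤ c * c' := by
  have hc : 0 ≤ c := (norm_nonneg _).trans h
  have h1 : (Uᴴ * (q * Z * q') * U * p).trace =
      ((q * U * p)ᴴ * Z * (q' * U * p) * p).trace := by
    rw [Matrix.conjTranspose_mul, Matrix.conjTranspose_mul, hq.eq, hp.isHermitian.eq]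
    calc _ = (Uᴴ * q * Z * q' * U * (p * p)).trace := by rw [hp2]; simp only [mul_assoc]
      _ = (p * (Uᴴ * q * Z * q' * U * p)).trace := by rw [← mul_assoc, Matrix.trace_mul_comm]
      _ = _ := by
        nth_rewrite 2 [← hp2]
        simp only [mul_assoc]
  rw [h1]
  refine (norm_trace_mul_le hp _).trans ?_
  rw [htr, Complex.one_re, mul_one]
  calc _ ≤ ‖(q * U * p)ᴴ‖ * ‖Z‖ * ‖q' * U * p‖ :=
        (norm_mul_le _ _).trans (mul_le_mul_of_nonneg_right (norm_mul_le _ _) (norm_nonneg _))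
    _ ≤ c * 1 * c' := by
        rw [Matrix.l2_opNorm_conjTranspose]
        gcongr
    _ = _ := by ring

lemma isHermitian_one_sub_ketbra {m : Type*} [DecidableEq m] {ψ : m → ℂ} :
    (1 - ketbra ψ).IsHermitian :=
  Matrix.isHermitian_one.sub (isHermitian_ketbra ψ)

variable {m e : Type*} [Fintype m] [DecidableEq m] [Fintype e] [DecidableEq e] {ψ : m → ℂ}

lemma one_sub_ketbra_mul_ketbra (hψ : star ψ ⬝ᵥ ψ = 1) : (1 - ketbra ψ) * ketbra ψ = 0 := by
  rw [sub_mul, one_mul, ketbra_mul_self hψ, sub_self]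

lemma one_sub_ketbra_mul_self (hψ : star ψ ⬝ᵥ ψ = 1) :
    (1 - ketbra ψ) * (1 - ketbra ψ) = 1 - ketbra ψ := by
  rw [mul_sub, mul_one, one_sub_ketbra_mul_ketbra hψ, sub_zero]

lemma norm_dotProduct_mulVec_le_one (hψ : star ψ ⬝ᵥ ψ = 1) {S : Matrix m m ℂ} (hS : ‖S‖ ≤ 1) :
    ‖star ψ ⬝ᵥ S *ᵥ ψ‖ ≤ 1 := by
  have := norm_dotProduct_mulVec_le S ψ
  rw [hψ, Complex.one_re, mul_one] at this
  exact this.trans hS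

/-- The part of an observable `S` which is sensitive to the complement of `ψ` has small
expectation in the bath sector `B`, if little amplitude `cQ` leaks from `p` to that
complement. -/
lemma norm_trace_sector_le (hψ : star ψ ⬝ᵥ ψ = 1) {B : Matrix e e ℂ} (hB : B.IsHermitian)
    (hB2 : B * B = B) {p U : Matrix (m × e) (m × e) ℂ} (hp : p.PosSemidef) (hp2 : p * p = p)
    (htr : p.trace = 1) {cP cQ : ℝ} (hP : ‖(ketbra ψ ⊗ₖ B) * U * p‖ ≤ cP)
    (hQ : ‖((1 - ketbra ψ) ⊗ₖ B) * U * p‖ ≤ cQ) {S : Matrix m m ℂ} (hS : ‖S‖ ≤ 1) :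
    ‖(Uᴴ * ((S - (star ψ ⬝ᵥ S *ᵥ ψ) • (1 : Matrix m m ℂ)) ⊗ₖ B) * U * p).trace‖ ≤
      2 * (cP * cQ) + 2 * cQ ^ 2 := by
  set s := star ψ ⬝ᵥ S *ᵥ ψ with hs
  have hs1 : ‖s‖ ≤ 1 := norm_dotProduct_mulVec_le_one hψ hS
  set P := ketbra ψ with hPdef
  set qP := P ⊗ₖ B
  set qQ := (1 - P) ⊗ₖ B
  set Z := S ⊗ₖ (1 : Matrix e e ℂ)
  have hZ : ‖Z‖ ≤ 1 := (norm_kronecker_one_le S).trans hS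
  have hone : ‖(1 : Matrix (m × e) (m × e) ℂ)‖ ≤ 1 :=
    norm_le_one_of_isSelfAdjoint_of_idempotent Matrix.isHermitian_one (one_mul 1)
  have hqP : qP.IsHermitian := by
    simp only [qP, Matrix.IsHermitian, Matrix.conjTranspose_kronecker, hB.eq,
      (isHermitian_ketbra ψ).eq, P]
  have hqQ : qQ.IsHermitian := by
    simp only [qQ, Matrix.IsHermitian, Matrix.conjTranspose_kronecker, hB.eq,
      isHermitian_one_sub_ketbra.eq, P]
  have hkr : ∀ X Y : Matrix m m ℂ, (X ⊗ₖ B) * Z * (Y ⊗ₖ B) = (X * S * Y) ⊗ₖ B := fun X Y => by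
    rw [← Matrix.mul_kronecker_mul, ← Matrix.mul_kronecker_mul, mul_one, hB2]
  have hdec : (S - s • (1 : Matrix m m ℂ)) ⊗ₖ B =
      qP * Z * qQ + qQ * Z * qP + qQ * Z * qQ - s • (qQ * 1 * qQ) := by
    rw [hkr, hkr, hkr, mul_one, ← Matrix.mul_kronecker_mul, hB2, ← Matrix.smul_kronecker,
      ← Matrix.add_kronecker, ← Matrix.add_kronecker, sub_eq_add_neg _ (_ ⊗ₖ B), ← neg_one_smul ℂ,
      ← Matrix.smul_kronecker, ← Matrix.add_kronecker, one_sub_ketbra_mul_self hψ]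
    congr 1
    have h1 : P * S * P = s • P := ketbra_mul_mul_ketbra S
    have h2 : P * S * (1 - P) + (1 - P) * S * P + (1 - P) * S * (1 - P) = S - P * S * P := by
      noncomm_ring
    rw [h2, h1, smul_sub]
    module
  rw [hdec]
  have h1 := norm_trace_leakage_le hp hp2 htr hqP hP hQ hZ
  have h2 := norm_trace_leakage_le hp hp2 htr hqQ hQ hP hZ
  have h3 := norm_trace_leakage_le hp hp2 htr hqQ hQ hQ hZ
  have h4 := norm_trace_leakage_le hp hp2 htr hqQ hQ hQ hone
  simp only [mul_add, mul_sub, add_mul, sub_mul, Matrix.trace_add, Matrix.trace_sub,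
    mul_smul_comm, smul_mul_assoc, Matrix.trace_smul] at h1 h2 h3 h4 ⊢
  refine (norm_sub_le _ _).trans ?_
  have h5 : ‖s • (Uᴴ * (qQ * 1 * qQ) * U * p).trace‖ ≤ cQ * cQ := by
    rw [norm_smul]
    exact (mul_le_of_le_one_left (norm_nonneg _) hs1).trans h4
  calc _ ≤ cP * cQ + cQ * cP + cQ * cQ + cQ * cQ := by
        refine add_le_add ((norm_add_le _ _).trans (add_le_add ((norm_add_le _ _).trans
          (add_le_add h1 h2)) h3)) h5
    _ = _ := by ring

/-- The reduced state of `U (|ψ⟩⟨ψ| ⊗ B) U†`, tested on an observable `S`. Only the amplitudes which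
leave `ψ` contribute, and they do so linearly only together with an amplitude which stays in `ψ`
in the same bath sector. -/
lemma norm_trace_reduced_sub_le (hψ : star ψ ⬝ᵥ ψ = 1) {B : Matrix e e ℂ} (hB : B.IsHermitian)
    (hB2 : B * B = B) (hBtr : B.trace = 1) {U : Matrix (m × e) (m × e) ℂ} (hU : Uᴴ * U = 1)
    {x η₀ η₁ : ℝ}
    (h0 : ‖((1 - ketbra ψ) ⊗ₖ B) * U * (ketbra ψ ⊗ₖ B)‖ ≤ η₀)
    (h1 : ‖((1 - ketbra ψ) ⊗ₖ (1 - B)) * U * (ketbra ψ ⊗ₖ B)‖ ≤ η₁)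
    (hx : ‖((1 : Matrix m m ℂ) ⊗ₖ (1 - B)) * U * (ketbra ψ ⊗ₖ B)‖ ≤ x)
    {S : Matrix m m ℂ} (hS : ‖S‖ ≤ 1) :
    ‖(S * (partialTrace (U * (ketbra ψ ⊗ₖ B) * Uᴴ) - ketbra ψ)).trace‖ ≤
      2 * η₀ + 2 * η₀ ^ 2 + (2 * (x * η₁) + 2 * η₁ ^ 2) := by
  set p := ketbra ψ ⊗ₖ B with hpdef
  set s := star ψ ⬝ᵥ S *ᵥ ψ with hs
  have hpH : p.IsHermitian := by
    simp only [hpdef, Matrix.IsHermitian, Matrix.conjTranspose_kronecker, hB.eq,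
      (isHermitian_ketbra ψ).eq]
  have hp2 : p * p = p := by
    rw [hpdef, ← Matrix.mul_kronecker_mul, hB2, ketbra_mul_self hψ]
  have hp : p.PosSemidef := by
    have := Matrix.posSemidef_conjTranspose_mul_self p
    rwa [hpH.eq, hp2] at this
  have htr : p.trace = 1 := by
    rw [hpdef, Matrix.trace_kronecker, hBtr, (isDensity_ketbra hψ).2, mul_one]
  have hp1 : ‖p‖ ≤ 1 := norm_le_one_of_isSelfAdjoint_of_idempotent hpH hp2
  have hU1 : ‖U‖ ≤ 1 := by
    have h := Matrix.l2_opNorm_conjTranspose_mul_self U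
    have hone : ‖(1 : Matrix (m × e) (m × e) ℂ)‖ ≤ 1 :=
      norm_le_one_of_isSelfAdjoint_of_idempotent Matrix.isHermitian_one (one_mul 1)
    rw [hU] at h
    nlinarith [norm_nonneg U]
  have hB1 : (1 - B).IsHermitian := Matrix.isHermitian_one.sub hB
  have hB12 : (1 - B) * (1 - B) = 1 - B := by
    rw [mul_sub, sub_mul, sub_mul, hB2]; simp
  have hPB : ‖p * U * p‖ ≤ 1 := by
    calc _ ≤ ‖p‖ * ‖U‖ * ‖p‖ :=
          (norm_mul_le _ _).trans (mul_le_mul_of_nonneg_right (norm_mul_le _ _) (norm_nonneg _))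
      _ ≤ 1 * 1 * 1 := by gcongr
      _ = 1 := by norm_num
  have hPB1 : ‖(ketbra ψ ⊗ₖ (1 - B)) * U * p‖ ≤ x := by
    have h2 : (ketbra ψ ⊗ₖ (1 - B)) * U * p =
        (ketbra ψ ⊗ₖ (1 : Matrix e e ℂ)) * (((1 : Matrix m m ℂ) ⊗ₖ (1 - B)) * U * p) := by
      rw [← mul_assoc, ← mul_assoc, ← Matrix.mul_kronecker_mul, mul_one, one_mul]
    rw [h2]
    refine (norm_mul_le _ _).trans (le_trans ?_ hx)
    exact mul_le_of_le_one_left (norm_nonneg _) ((norm_kronecker_one_le _).trans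
      (norm_le_one_of_isSelfAdjoint_of_idempotent (isHermitian_ketbra ψ) (ketbra_mul_self hψ)))
  have hA := norm_trace_sector_le hψ hB hB2 hp hp2 htr hPB h0 hS
  have hC := norm_trace_sector_le hψ hB1 hB12 hp hp2 htr hPB1 h1 hS
  have hmain : (S * (partialTrace (U * p * Uᴴ) - ketbra ψ)).trace =
      (Uᴴ * ((S - s • (1 : Matrix m m ℂ)) ⊗ₖ B) * U * p).trace +
        (Uᴴ * ((S - s • (1 : Matrix m m ℂ)) ⊗ₖ (1 - B)) * U * p).trace := by
    have h2 : (Uᴴ * ((S - s • (1 : Matrix m m ℂ)) ⊗ₖ B) * U * p).trace +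
        (Uᴴ * ((S - s • (1 : Matrix m m ℂ)) ⊗ₖ (1 - B)) * U * p).trace =
        (Uᴴ * ((S - s • (1 : Matrix m m ℂ)) ⊗ₖ (1 : Matrix e e ℂ)) * U * p).trace := by
      rw [← Matrix.trace_add, ← add_mul, ← add_mul, ← mul_add, ← Matrix.kronecker_add,
        add_sub_cancel]
    have h3 : (S - s • (1 : Matrix m m ℂ)) ⊗ₖ (1 : Matrix e e ℂ) =
        S ⊗ₖ (1 : Matrix e e ℂ) - s • (1 : Matrix (m × e) (m × e) ℂ) := by
      rw [sub_eq_add_neg, ← neg_smul, Matrix.add_kronecker, Matrix.smul_kronecker,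
        Matrix.one_kronecker_one, neg_smul, ← sub_eq_add_neg]
    rw [h2, h3, mul_sub, Matrix.trace_sub, trace_mul_partialTrace, trace_mul_ketbra, ← hs]
    simp only [mul_sub, sub_mul, Matrix.trace_sub, mul_smul_comm, smul_mul_assoc, mul_one, hU,
      Matrix.trace_smul, one_mul, htr, smul_eq_mul]
    congr 1
    rw [← mul_assoc, Matrix.trace_mul_comm]
    simp only [mul_assoc]
  rw [hmain]
  refine (norm_add_le _ _).trans (add_le_add (hA.trans (le_of_eq ?_)) hC)
  ring

end Leakage

/-! ### The joint evolution of system and bath -/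

section JointEvolution

variable {N : ℕ} {H A : Matrix (Fin N) (Fin N) ℂ} {ω σ α T e Δ : ℝ} {ψ₀ : Fin N → ℂ}

/-- The coupling operator `A ⊗ B_E + A† ⊗ B_E†`. -/
def coupling (A : Matrix (Fin N) (Fin N) ℂ) : Matrix (Fin N × Fin 2) (Fin N × Fin 2) ℂ :=
  A ⊗ₖ bathCoupling + Aᴴ ⊗ₖ bathCouplingᴴ

/-- The free Hamiltonian of system and bath, with its energy measured from `e`. -/
def shiftedHamiltonian (H : Matrix (Fin N) (Fin N) ℂ) (ω e : ℝ) :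
    Matrix (Fin N × Fin 2) (Fin N × Fin 2) ℂ :=
  H ⊗ₖ (1 : Matrix (Fin 2) (Fin 2) ℂ) + (1 : Matrix (Fin N) (Fin N) ℂ) ⊗ₖ bathHamiltonian ω -
    (e : ℂ) • 1

lemma norm_coupling_le (hA : ‖A‖ ≤ 1) : ‖coupling A‖ ≤ 2 := by
  have h1 := norm_bathCoupling_le
  have h2 : ‖bathCouplingᴴ‖ ≤ 1 := by rwa [Matrix.l2_opNorm_conjTranspose]
  have h3 : ‖Aᴴ‖ ≤ 1 := by rwa [Matrix.l2_opNorm_conjTranspose]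
  calc _ ≤ ‖A‖ * ‖bathCoupling‖ + ‖Aᴴ‖ * ‖bathCouplingᴴ‖ :=
        (norm_add_le _ _).trans (add_le_add (norm_kronecker_le _ _) (norm_kronecker_le _ _))
    _ ≤ 1 * 1 + 1 * 1 := by gcongr
    _ = 2 := by norm_num

lemma isHermitian_coupling (A : Matrix (Fin N) (Fin N) ℂ) : (coupling A).IsHermitian := by
  simp [coupling, Matrix.IsHermitian, Matrix.conjTranspose_kronecker, add_comm]

lemma isHermitian_ofReal_smul {n : Type*} {B : Matrix n n ℂ} (hB : B.IsHermitian) (r : ℝ) :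
    ((r : ℂ) • B).IsHermitian := by
  rw [Matrix.IsHermitian, Matrix.conjTranspose_smul, hB.eq]
  simp

lemma isHermitian_kronecker {m n : Type*} {A : Matrix m m ℂ} {B : Matrix n n ℂ}
    (hA : A.IsHermitian) (hB : B.IsHermitian) : (A ⊗ₖ B).IsHermitian := by
  rw [Matrix.IsHermitian, Matrix.conjTranspose_kronecker, hA.eq, hB.eq]

lemma isHermitian_shiftedHamiltonian (hH : H.IsHermitian) (ω e : ℝ) :
    (shiftedHamiltonian H ω e).IsHermitian :=
  ((isHermitian_kronecker hH Matrix.isHermitian_one).add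
    (isHermitian_kronecker Matrix.isHermitian_one (isHermitian_bathHamiltonian ω))).sub
    (isHermitian_ofReal_smul Matrix.isHermitian_one e)

lemma totalHamiltonian_eq (H A : Matrix (Fin N) (Fin N) ℂ) (ω σ α t e : ℝ) :
    (-Complex.I) • totalHamiltonian H A ω σ α t =
      -Complex.I • (shiftedHamiltonian H ω e + (e : ℂ) • 1) +
        (-Complex.I * α * control σ t) • coupling A := by
  rw [totalHamiltonian, shiftedHamiltonian, coupling]
  push_cast
  module

lemma continuous_totalHamiltonian :
    Continuous fun t => (-Complex.I) • totalHamiltonian H A ω σ α t := by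
  have := continuous_control σ
  simp only [totalHamiltonian_eq H A ω σ α _ 0]
  fun_prop

lemma timeOrderedExp_self {m : Type*} [Fintype m] [DecidableEq m] (K : ℝ → Matrix m m ℂ)
    (t₀ : ℝ) : timeOrderedExp K t₀ t₀ = 1 := by
  rw [timeOrderedExp, tsum_eq_single 0]
  · rfl
  · intro n hn
    obtain ⟨n, rfl⟩ := Nat.exists_eq_succ_of_ne_zero hn
    exact intervalIntegral.integral_same

lemma commute_kronecker {m n : Type*} [Fintype m] [Fintype n] {A A' : Matrix m m ℂ}
    {B B' : Matrix n n ℂ} (hA : Commute A A') (hB : Commute B B') :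
    Commute (A ⊗ₖ B) (A' ⊗ₖ B') := by
  rw [Commute, SemiconjBy, ← Matrix.mul_kronecker_mul, ← Matrix.mul_kronecker_mul, hA.eq, hB.eq]

lemma commute_shiftedHamiltonian {q : Matrix (Fin N) (Fin N) ℂ} {B : Matrix (Fin 2) (Fin 2) ℂ}
    (hq : Commute q H) (hB : Commute B (bathHamiltonian ω)) :
    Commute (q ⊗ₖ B) (shiftedHamiltonian H ω e) :=
  ((commute_kronecker hq (Commute.one_right B)).add_right
    (commute_kronecker (Commute.one_right q) hB)).sub_right
    ((Commute.one_right _).smul_right _)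

lemma commute_of_mul_eq_smul {n : Type*} [Fintype n] {p h : Matrix n n ℂ} (hp : p.IsHermitian)
    (hh : h.IsHermitian) {r : ℝ} (hr : h * p = (r : ℂ) • p) : Commute p h := by
  have := congrArg Matrix.conjTranspose hr
  rw [Matrix.conjTranspose_mul, hh.eq, hp.eq, (isHermitian_ofReal_smul hp r).eq] at this
  rw [Commute, SemiconjBy, this, hr]

/-- Imaginary-time evolution by `σ` damps the complement of the ground state by `e^{-Δσ}`. -/
lemma norm_mul_propagator_le (hH : H.IsHermitian) {E₀ : ℝ}
    (hE : H * ketbra ψ₀ = (E₀ : ℂ) • ketbra ψ₀) (hψ : star ψ₀ ⬝ᵥ ψ₀ = 1)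
    (hpos : (H - (E₀ : ℂ) • (1 : Matrix (Fin N) (Fin N) ℂ) -
      (Δ : ℂ) • (1 - ketbra ψ₀)).PosSemidef) (hσ : 0 < σ)
    {B : Matrix (Fin 2) (Fin 2) ℂ} (hB : Commute B (bathHamiltonian ω))
    (hq1 : ‖(1 - ketbra ψ₀) ⊗ₖ B‖ ≤ 1) :
    ‖((1 - ketbra ψ₀) ⊗ₖ B) * propagator (shiftedHamiltonian H ω (E₀ - |ω| / 2))
      (σ * Complex.I)‖ ≤ Real.exp (-(Δ * σ)) := by
  set q := (1 - ketbra ψ₀) ⊗ₖ B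
  set a := shiftedHamiltonian H ω (E₀ - |ω| / 2) with ha
  -- `b ≥ Δ` agrees with `a` on the complement of the ground state.
  set b := a + (Δ : ℂ) • (ketbra ψ₀ ⊗ₖ (1 : Matrix (Fin 2) (Fin 2) ℂ)) with hb
  have hPH : Commute (ketbra ψ₀) H := commute_of_mul_eq_smul (isHermitian_ketbra ψ₀) hH hE
  have hQP : Commute (1 - ketbra ψ₀) (ketbra ψ₀) :=
    (Commute.one_left _).sub_left (Commute.refl _)
  have hqa : Commute q a :=
    commute_shiftedHamiltonian ((Commute.one_left H).sub_left hPH) hB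
  have hqb : Commute q b :=
    hqa.add_right ((commute_kronecker hQP (Commute.one_right B)).smul_right _)
  have hqP : q * (ketbra ψ₀ ⊗ₖ (1 : Matrix (Fin 2) (Fin 2) ℂ)) = 0 := by
    rw [← Matrix.mul_kronecker_mul, one_sub_ketbra_mul_ketbra hψ, Matrix.zero_kronecker]
  have hab : q * (-(σ : ℂ) • a) = q * (-(σ : ℂ) • b) := by
    rw [hb]
    simp only [smul_add, mul_add, mul_smul_comm, hqP, smul_zero, add_zero]
  have hprop : propagator a (σ * Complex.I) = NormedSpace.exp (-(σ : ℂ) • a) := by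
    rw [propagator, smul_smul, mul_assoc, Complex.I_mul_I, mul_neg_one]
  rw [hprop, mul_exp_eq_mul_exp (hqb.smul_right _) hab]
  have hbH : b.IsHermitian := (isHermitian_shiftedHamiltonian hH _ _).add
    (isHermitian_ofReal_smul (isHermitian_kronecker (isHermitian_ketbra ψ₀)
      Matrix.isHermitian_one) _)
  have hbΔ : (b - (Δ : ℂ) • (1 : Matrix (Fin N × Fin 2) (Fin N × Fin 2) ℂ)).PosSemidef := by
    have h1 := (hpos.kronecker (Matrix.PosSemidef.one (n := Fin 2) (R := ℂ))).add
      ((Matrix.PosSemidef.one (n := Fin N) (R := ℂ)).kronecker (posSemidef_bathHamiltonian_add ω))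
    refine cast (congrArg Matrix.PosSemidef ?_) h1
    rw [hb, ha, shiftedHamiltonian, ← Matrix.one_kronecker_one (α := ℂ) (m := Fin N) (n := Fin 2)]
    simp only [sub_eq_add_neg, ← neg_smul, Matrix.add_kronecker, Matrix.kronecker_add,
      Matrix.smul_kronecker, Matrix.kronecker_smul, ← neg_one_smul ℂ (ketbra ψ₀)]
    push_cast
    module
  have hle : -(σ : ℂ) • b ≤ algebraMap ℝ _ (-(Δ * σ)) := by
    rw [Matrix.le_iff]
    have h1 := hbΔ.smul (a := (σ : ℂ)) (Complex.zero_le_real.2 hσ.le)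
    refine cast (congrArg Matrix.PosSemidef ?_) h1
    rw [Algebra.algebraMap_eq_smul_one, ← Complex.coe_smul]
    push_cast
    module
  have hs : IsSelfAdjoint (-(σ : ℂ) • b) := by
    have := isHermitian_ofReal_smul hbH (-σ)
    rwa [Complex.ofReal_neg] at this
  refine (norm_mul_le _ _).trans ?_
  exact (mul_le_of_le_one_left (norm_nonneg _) hq1).trans (norm_exp_le_of_le_algebraMap hs hle)

lemma exists_norm_totalHamiltonian_le (hσ : 0 < σ) :
    ∃ M, ∀ s, ‖(-Complex.I) • totalHamiltonian H A ω σ α s‖ ≤ M := by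
  refine ⟨‖-Complex.I • (shiftedHamiltonian H ω 0 + ((0 : ℝ) : ℂ) • 1)‖ +
    |α| * (1 / √σ) * ‖coupling A‖, fun s => ?_⟩
  rw [totalHamiltonian_eq H A ω σ α s 0]
  refine (norm_add_le _ _).trans (add_le_add le_rfl ?_)
  rw [norm_smul]
  simp only [norm_mul, norm_neg, Complex.norm_I, one_mul, Complex.norm_real, Real.norm_eq_abs,
    abs_of_pos (control_pos hσ s)]
  gcongr
  exact control_le hσ s

variable [Nonempty (Fin N)]

/-- The time-ordered exponential solves the Schrödinger equation. -/
lemma hasDerivAt_evolution (hσ : 0 < σ) (t : ℝ) :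
    HasDerivAt (timeOrderedExp (fun s => (-Complex.I) • totalHamiltonian H A ω σ α s) (-T))
      ((-Complex.I) • totalHamiltonian H A ω σ α t *
        timeOrderedExp (fun s => (-Complex.I) • totalHamiltonian H A ω σ α s) (-T) t) t := by
  obtain ⟨M, hM⟩ := exists_norm_totalHamiltonian_le (H := H) (A := A) (ω := ω) (α := α) hσ
  have h : timeOrderedExp (fun s => (-Complex.I) • totalHamiltonian H A ω σ α s) (-T) = fun t =>
      ∑' n, dysonSeq (fun s => (-Complex.I) • totalHamiltonian H A ω σ α s) (-T) n t :=
    funext fun t => by simp only [timeOrderedExp, dysonTerm_eq_dysonSeq]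
  rw [h]
  exact hasDerivAt_tsum_dysonSeq continuous_totalHamiltonian hM t

lemma evolution_conjTranspose_mul_self (hH : H.IsHermitian) (hσ : 0 < σ) (A) (ω α T : ℝ) :
    (evolution H A ω σ α T)ᴴ * evolution H A ω σ α T = 1 := by
  refine star_mul_self_of_skewAdjoint (timeOrderedExp_self _ (-T)) (hasDerivAt_evolution hσ)
    (fun t => ?_) T
  have h : (totalHamiltonian H A ω σ α t).IsHermitian :=
    ((isHermitian_kronecker hH Matrix.isHermitian_one).add
      (isHermitian_kronecker Matrix.isHermitian_one (isHermitian_bathHamiltonian ω))).add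
      (isHermitian_ofReal_smul (isHermitian_coupling A) _)
  rw [Matrix.star_eq_conjTranspose, Matrix.conjTranspose_smul, h.eq]
  simp

lemma isEvolution_timeOrderedExp (hσ : 0 < σ) : IsEvolution (shiftedHamiltonian H ω e) (coupling A)
    e σ α T (timeOrderedExp (fun s => (-Complex.I) • totalHamiltonian H A ω σ α s) (-T)) :=
  ⟨timeOrderedExp_self _ _, fun t => by
    rw [← totalHamiltonian_eq]
    exact hasDerivAt_evolution hσ t⟩

/-- One run of the joint evolution from the ground state: the reduced state, tested on any
observable, up to errors of order `δ x²` that are uniform in the coupling `A` and in `ω`. -/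
lemma norm_trace_single_run_le (h : HasGappedGroundState H Δ ψ₀) (hA : ‖A‖ ≤ 1) (hσ : 0 < σ)
    (hα : 0 < α) (hT : 0 ≤ T) (ω : ℝ) {x δ : ℝ} (hx : x = 16 * α * √σ)
    (hδ : δ = Real.exp (-(Δ * σ)) + Real.exp (-T ^ 2 / (8 * σ ^ 2)))
    {S : Matrix (Fin N) (Fin N) ℂ} (hS : ‖S‖ ≤ 1) :
    ‖(S * (partialTrace (evolution H A ω σ α T * (ketbra ψ₀ ⊗ₖ bathGround ω) *
        (evolution H A ω σ α T)ᴴ) - ketbra ψ₀)).trace‖ ≤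
      2 * (δ * (x ^ 2 * Real.exp x)) + 2 * (δ * (x ^ 2 * Real.exp x)) ^ 2 +
        (2 * (x * Real.exp x * (δ * (x ^ 1 * Real.exp x))) +
          2 * (δ * (x ^ 1 * Real.exp x)) ^ 2) := by
  obtain ⟨E₀, hE, hpos⟩ := h.exists_posSemidef
  have hψ := h.unit
  have hH := h.hermitian
  set a := shiftedHamiltonian H ω (E₀ - |ω| / 2) with ha
  set B := bathGround ω
  have hB : B.IsHermitian := isHermitian_bathGround ω
  have hB2 : B * B = B := bathGround_mul_self ω
  have hB1 : (1 - B).IsHermitian := Matrix.isHermitian_one.sub hB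
  have hB12 : (1 - B) * (1 - B) = 1 - B := by
    rw [mul_sub, sub_mul, sub_mul, hB2]; simp
  have hB10 : (1 - B) * B = 0 := by rw [sub_mul, hB2, one_mul, sub_self]
  have hcB : Commute B (bathHamiltonian ω) :=
    commute_of_mul_eq_smul hB (isHermitian_bathHamiltonian ω) (bathHamiltonian_mul_bathGround ω)
  have hcB1 : Commute (1 - B) (bathHamiltonian ω) := (Commute.one_left _).sub_left hcB
  have hcP : Commute (ketbra ψ₀) H := commute_of_mul_eq_smul (isHermitian_ketbra ψ₀) hH hE
  have hcQ : Commute (1 - ketbra ψ₀) H := (Commute.one_left H).sub_left hcP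
  have haH : IsSelfAdjoint a := isHermitian_shiftedHamiltonian hH _ _
  have hproj : ∀ {P : Matrix (Fin N) (Fin N) ℂ} {C : Matrix (Fin 2) (Fin 2) ℂ}, P.IsHermitian →
      P * P = P → C.IsHermitian → C * C = C → ‖P ⊗ₖ C‖ ≤ 1 := fun hP hP2 hC hC2 =>
    norm_le_one_of_isSelfAdjoint_of_idempotent (isHermitian_kronecker hP hC)
      (by rw [← Matrix.mul_kronecker_mul, hP2, hC2])
  have hQH : (1 - ketbra ψ₀).IsHermitian := isHermitian_one_sub_ketbra
  have hQ2 := one_sub_ketbra_mul_self hψ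
  have hp1 := hproj (isHermitian_ketbra ψ₀) (ketbra_mul_self hψ) hB hB2
  have hq0 := hproj hQH hQ2 hB hB2
  have hq1 := hproj hQH hQ2 hB1 hB12
  have hr := hproj Matrix.isHermitian_one (one_mul 1) hB1 hB12
  have hap : a * (ketbra ψ₀ ⊗ₖ B) = 0 := by
    rw [ha, shiftedHamiltonian, sub_mul, add_mul, ← Matrix.mul_kronecker_mul,
      ← Matrix.mul_kronecker_mul, one_mul, one_mul, hE, bathHamiltonian_mul_bathGround,
      Matrix.smul_kronecker, Matrix.kronecker_smul, smul_mul_assoc, one_mul]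
    push_cast
    module
  have hU := isEvolution_timeOrderedExp (H := H) (A := A) (ω := ω) (α := α) (T := T)
    (e := E₀ - |ω| / 2) hσ
  have hX := norm_coupling_le hA
  have hδ0 : ∀ {C : Matrix (Fin 2) (Fin 2) ℂ}, Commute C (bathHamiltonian ω) →
      ‖(1 - ketbra ψ₀) ⊗ₖ C‖ ≤ 1 → ‖((1 - ketbra ψ₀) ⊗ₖ C) * propagator a (σ * Complex.I)‖ +
        Real.exp (-T ^ 2 / (8 * σ ^ 2)) ≤ δ := fun hC hC1 => by
    rw [hδ]
    gcongr
    exact norm_mul_propagator_le hH hE hψ hpos hσ hC hC1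
  have hqp : ∀ C : Matrix (Fin 2) (Fin 2) ℂ,
      ((1 - ketbra ψ₀) ⊗ₖ C) * (ketbra ψ₀ ⊗ₖ B) = 0 := fun C => by
    rw [← Matrix.mul_kronecker_mul, one_sub_ketbra_mul_ketbra hψ, Matrix.zero_kronecker]
  have hrp : ((1 : Matrix (Fin N) (Fin N) ℂ) ⊗ₖ (1 - B)) * (ketbra ψ₀ ⊗ₖ B) = 0 := by
    rw [← Matrix.mul_kronecker_mul, hB10, Matrix.kronecker_zero]
  -- The coupling flips the bath, so that it has no block from the bath ground state to itself.
  have hqX : ((1 - ketbra ψ₀) ⊗ₖ B) * coupling A * (ketbra ψ₀ ⊗ₖ B) = 0 := by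
    rw [coupling, mul_add, add_mul]
    simp only [← Matrix.mul_kronecker_mul]
    rw [bathGround_mul_bathCoupling_mul_bathGround,
      bathGround_mul_bathCoupling_conjTranspose_mul_bathGround]
    simp
  rw [hx]
  exact norm_trace_reduced_sub_le hψ hB hB2 (trace_bathGround ω)
    (evolution_conjTranspose_mul_self hH hσ A ω α T)
    (hU.norm_gapped_corner_le haH hσ hα hX hT hap hp1 hq0 (commute_shiftedHamiltonian hcQ hcB)
      (hqp _) (hδ0 hcB hq0) (j := 2) one_le_two le_rfl fun _ => hqX)
    (hU.norm_gapped_corner_le haH hσ hα hX hT hap hp1 hq1 (commute_shiftedHamiltonian hcQ hcB1)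
      (hqp _) (hδ0 hcB1 hq1) (j := 1) le_rfl one_le_two fun h => by omega)
    (hU.norm_corner_le haH hσ hα hX hT hap hp1 hr
      (commute_shiftedHamiltonian (Commute.one_left H) hcB1) hrp) hS

end JointEvolution

/-! ### The channel -/

section Channel

variable {N : ℕ} {H A : Matrix (Fin N) (Fin N) ℂ} {ω σ α T : ℝ} {ρ ρ' : Matrix (Fin N) (Fin N) ℂ}
  {𝒜 : Finset (Matrix (Fin N) (Fin N) ℂ)} {g : ℝ → ℝ}

/-- The reduced state after one run of the joint evolution, for fixed `A` and `ω`. -/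
def runOutput (H A : Matrix (Fin N) (Fin N) ℂ) (σ T α ω : ℝ) (ρ : Matrix (Fin N) (Fin N) ℂ) :
    Matrix (Fin N) (Fin N) ℂ :=
  partialTrace (evolution H A ω σ α T * (ρ ⊗ₖ bathGround ω) * (evolution H A ω σ α T)ᴴ)

/-- The partial trace as a continuous linear map. -/
def partialTraceCLM (m e : Type*) [Fintype m] [DecidableEq m] [Fintype e] [DecidableEq e] :
    Matrix (m × e) (m × e) ℂ →L[ℂ] Matrix m m ℂ :=
  LinearMap.toContinuousLinearMap
    { toFun := partialTrace
      map_add' := fun M M' => by ext i j; simp [partialTrace, Finset.sum_add_distrib]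
      map_smul' := fun c M => by ext i j; simp [partialTrace, Finset.mul_sum] }

lemma posSemidef_partialTrace {m e : Type*} [Fintype m] [Fintype e]
    {M : Matrix (m × e) (m × e) ℂ} (hM : M.PosSemidef) : (partialTrace M).PosSemidef := by
  have h : partialTrace M = ∑ b, M.submatrix (fun i => (i, b)) (fun i => (i, b)) := by
    ext i j
    simp [partialTrace, Matrix.sum_apply]
  rw [h]
  exact Matrix.posSemidef_sum _ fun b _ => hM.submatrix _

lemma posSemidef_bathGround (ω : ℝ) : (bathGround ω).PosSemidef := by
  have := Matrix.posSemidef_conjTranspose_mul_self (bathGround ω)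
  rwa [(isHermitian_bathGround ω).eq, bathGround_mul_self] at this

lemma posSemidef_runOutput (hρ : ρ.PosSemidef) : (runOutput H A σ T α ω ρ).PosSemidef :=
  posSemidef_partialTrace ((hρ.kronecker (posSemidef_bathGround ω)).mul_mul_conjTranspose_same _)

lemma runOutput_add (ρ ρ' : Matrix (Fin N) (Fin N) ℂ) :
    runOutput H A σ T α ω (ρ + ρ') = runOutput H A σ T α ω ρ + runOutput H A σ T α ω ρ' := by
  rw [runOutput, Matrix.add_kronecker, mul_add, add_mul]
  exact map_add (partialTraceCLM (Fin N) (Fin 2)) _ _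

lemma continuous_dysonSeq_param {X 𝔸 : Type*} [TopologicalSpace X] [CStarAlgebra 𝔸]
    {K : X → ℝ → 𝔸} (hK : Continuous (Function.uncurry K)) (t₀ : ℝ) (n : ℕ) :
    Continuous fun q : X × ℝ => dysonSeq (K q.1) t₀ n q.2 := by
  induction n with
  | zero => exact continuous_const
  | succ n ih =>
    refine intervalIntegral.continuous_parametric_intervalIntegral_of_continuous
      (f := fun (q : X × ℝ) s => K q.1 s * dysonSeq (K q.1) t₀ n s) ?_ continuous_snd
    have h1 : Continuous fun r : (X × ℝ) × ℝ => (r.1.1, r.2) := by fun_prop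
    exact (hK.comp h1).mul (ih.comp h1)

lemma posSemidef_channel (hg : ∀ ω, 0 ≤ g ω) (hρ : ρ.PosSemidef) :
    (channel H 𝒜 g σ T α ρ).PosSemidef := by
  refine Matrix.PosSemidef.smul ?_ (by simp)
  refine Matrix.posSemidef_sum _ fun A _ => ?_
  refine Matrix.nonneg_iff_posSemidef.1 (integral_nonneg fun ω => ?_)
  exact Matrix.nonneg_iff_posSemidef.2
    ((posSemidef_runOutput hρ).smul (Complex.zero_le_real.2 (hg ω)))

section Nonempty

variable [Nonempty (Fin N)]

lemma norm_evolution_le (hH : H.IsHermitian) (hσ : 0 < σ) : ‖evolution H A ω σ α T‖ ≤ 1 := by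
  have h := Matrix.l2_opNorm_conjTranspose_mul_self (evolution H A ω σ α T)
  rw [evolution_conjTranspose_mul_self hH hσ, norm_one] at h
  nlinarith [norm_nonneg (evolution H A ω σ α T)]

lemma stronglyMeasurable_evolution (H A : Matrix (Fin N) (Fin N) ℂ) (hσ : 0 < σ) (α T : ℝ) :
    StronglyMeasurable fun ω => evolution H A ω σ α T := by
  let L : ℝ → ℝ → Matrix (Fin N × Fin 2) (Fin N × Fin 2) ℂ :=
    fun ω s => (-Complex.I) • totalHamiltonian H A ω σ α s
  have hL : Continuous (Function.uncurry L) := by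
    have hc := continuous_control σ
    have hb : Continuous fun q : ℝ × ℝ =>
        (1 : Matrix (Fin N) (Fin N) ℂ) ⊗ₖ bathHamiltonian q.1 := by
      simp only [bathHamiltonian, Matrix.kronecker_smul]
      fun_prop
    simp only [L, Function.uncurry_def, totalHamiltonian_eq H A _ σ α _ 0, shiftedHamiltonian]
    fun_prop
  refine stronglyMeasurable_of_tendsto atTop
    (f := fun n ω => ∑ j ∈ Finset.range n, dysonSeq (L ω) (-T) j T) (fun n => ?_) ?_
  · refine Finset.stronglyMeasurable_fun_sum _ fun j _ => Continuous.stronglyMeasurable ?_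
    exact Continuous.comp (g := fun q : ℝ × ℝ => dysonSeq (L q.1) (-T) j q.2)
      (f := fun ω : ℝ => (ω, T)) (continuous_dysonSeq_param hL (-T) j) (by fun_prop)
  · rw [tendsto_pi_nhds]
    intro ω
    obtain ⟨M, hM⟩ := exists_norm_totalHamiltonian_le (H := H) (A := A) (ω := ω) (α := α) hσ
    have hs : Summable fun n => dysonSeq (L ω) (-T) n T :=
      Summable.of_norm_bounded (Real.summable_pow_div_factorial _)
        fun n => norm_dysonSeq_le_of_bounded continuous_totalHamiltonian hM n T
    have h : evolution H A ω σ α T = ∑' n, dysonSeq (L ω) (-T) n T := by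
      simp only [evolution, timeOrderedExp, dysonTerm_eq_dysonSeq, L]
    rw [h]
    exact hs.hasSum.tendsto_sum_nat

lemma stronglyMeasurable_bathGround : StronglyMeasurable bathGround := by
  unfold bathGround
  exact StronglyMeasurable.ite measurableSet_Ici stronglyMeasurable_const stronglyMeasurable_const

lemma integrable_smul_runOutput (hH : H.IsHermitian) (hσ : 0 < σ) (hg : Integrable g)
    (A ρ : Matrix (Fin N) (Fin N) ℂ) :
    Integrable fun ω => (g ω : ℂ) • runOutput H A σ T α ω ρ := by
  have hU := stronglyMeasurable_evolution H A hσ α T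
  have hk : StronglyMeasurable fun ω => ρ ⊗ₖ bathGround ω := by
    have hc : Continuous fun B : Matrix (Fin 2) (Fin 2) ℂ => ρ ⊗ₖ B := by
      refine continuous_matrix fun i j => ?_
      simp only [Matrix.kroneckerMap_apply]
      fun_prop
    exact hc.comp_stronglyMeasurable stronglyMeasurable_bathGround
  have hm : StronglyMeasurable fun ω => runOutput H A σ T α ω ρ :=
    (partialTraceCLM (Fin N) (Fin 2)).continuous.comp_stronglyMeasurable
      ((hU.mul hk).mul (continuous_star.comp_stronglyMeasurable hU))
  refine Integrable.smul_bdd (φ := fun ω => (g ω : ℂ)) hg.ofReal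
    (‖partialTraceCLM (Fin N) (Fin 2)‖ * ‖ρ‖) hm.aestronglyMeasurable (ae_of_all _ fun ω => ?_)
  refine ((partialTraceCLM (Fin N) (Fin 2)).le_opNorm _).trans ?_
  gcongr
  have h1 : ‖evolution H A ω σ α T‖ ≤ 1 := norm_evolution_le hH hσ
  have h2 : ‖(evolution H A ω σ α T)ᴴ‖ ≤ 1 := by rwa [Matrix.l2_opNorm_conjTranspose]
  have h3 : ‖bathGround ω‖ ≤ 1 :=
    norm_le_one_of_isSelfAdjoint_of_idempotent (isHermitian_bathGround ω) (bathGround_mul_self ω)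
  calc _ ≤ ‖evolution H A ω σ α T‖ * ‖ρ ⊗ₖ bathGround ω‖ * ‖(evolution H A ω σ α T)ᴴ‖ :=
        (norm_mul_le _ _).trans (mul_le_mul_of_nonneg_right (norm_mul_le _ _) (norm_nonneg _))
    _ ≤ 1 * (‖ρ‖ * 1) * 1 := by
        gcongr
        exact (norm_kronecker_le _ _).trans (by gcongr)
    _ = ‖ρ‖ := by ring

lemma channel_add (hH : H.IsHermitian) (hσ : 0 < σ) (hg : Integrable g)
    (ρ ρ' : Matrix (Fin N) (Fin N) ℂ) :
    channel H 𝒜 g σ T α (ρ + ρ') = channel H 𝒜 g σ T α ρ + channel H 𝒜 g σ T α ρ' := by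
  have h : ∀ A, ∫ ω : ℝ, (g ω : ℂ) • runOutput H A σ T α ω (ρ + ρ') =
      (∫ ω : ℝ, (g ω : ℂ) • runOutput H A σ T α ω ρ) +
        ∫ ω : ℝ, (g ω : ℂ) • runOutput H A σ T α ω ρ' := fun A => by
    rw [← integral_add (integrable_smul_runOutput hH hσ hg A ρ)
      (integrable_smul_runOutput hH hσ hg A ρ')]
    simp only [runOutput_add, smul_add]
  change (𝒜.card : ℂ)⁻¹ • ∑ A ∈ 𝒜, ∫ ω : ℝ, (g ω : ℂ) • runOutput H A σ T α ω (ρ + ρ') = _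
  simp only [h, Finset.sum_add_distrib, smul_add]
  rfl

/-- A linear functional which is within `c` of `z` on the output of every single run is within
`c` of `z` on the output of the channel. -/
lemma norm_functional_channel_sub_le (hH : H.IsHermitian) (hσ : 0 < σ) (h𝒜 : IsAdmissible 𝒜 g)
    (L : Matrix (Fin N) (Fin N) ℂ →ₗ[ℂ] ℂ) {z : ℂ} {c : ℝ}
    (hL : ∀ A ∈ 𝒜, ∀ ω, ‖L (runOutput H A σ T α ω ρ) - z‖ ≤ c) :
    ‖L (channel H 𝒜 g σ T α ρ) - z‖ ≤ c := by
  have hg := h𝒜.density_integrable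
  have hcard : (𝒜.card : ℂ) ≠ 0 := by
    exact_mod_cast (Finset.card_pos.2 h𝒜.nonempty).ne'
  have hgz : ∫ ω, (g ω : ℂ) * z = z := by
    rw [integral_mul_const, integral_complex_ofReal, h𝒜.density_integral]
    simp
  have hA : ∀ A ∈ 𝒜, ‖L (∫ ω : ℝ, (g ω : ℂ) • runOutput H A σ T α ω ρ) - z‖ ≤ c := by
    intro A hA
    have hint := integrable_smul_runOutput (T := T) (α := α) hH hσ hg A ρ
    have h1 := (LinearMap.toContinuousLinearMap L).integral_comp_comm hint
    simp only [LinearMap.coe_toContinuousLinearMap'] at h1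
    have h2 : Integrable fun ω => L ((g ω : ℂ) • runOutput H A σ T α ω ρ) :=
      (LinearMap.toContinuousLinearMap L).integrable_comp hint
    have h3 : Integrable fun ω => (g ω : ℂ) * z := hg.ofReal.mul_const z
    rw [← h1]
    nth_rewrite 1 [← hgz]
    rw [← integral_sub h2 h3]
    calc _ ≤ ∫ ω, g ω * c := by
          refine norm_integral_le_of_norm_le (hg.mul_const c) (ae_of_all _ fun ω => ?_)
          rw [map_smul, smul_eq_mul, ← mul_sub, norm_mul, Complex.norm_real,
            Real.norm_of_nonneg (h𝒜.density_nonneg ω)]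
          exact mul_le_mul_of_nonneg_left (hL A hA ω) (h𝒜.density_nonneg ω)
      _ = c := by rw [integral_mul_const, h𝒜.density_integral, one_mul]
  have hsum : L (channel H 𝒜 g σ T α ρ) - z = (𝒜.card : ℂ)⁻¹ *
      ∑ A ∈ 𝒜, (L (∫ ω : ℝ, (g ω : ℂ) • runOutput H A σ T α ω ρ) - z) := by
    rw [Finset.sum_sub_distrib, Finset.sum_const, nsmul_eq_mul, mul_sub, ← mul_assoc,
      inv_mul_cancel₀ hcard, one_mul, ← map_sum, ← smul_eq_mul, ← map_smul]
    rfl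
  rw [hsum, norm_mul, norm_inv, Complex.norm_natCast]
  have hcard' : (0 : ℝ) < 𝒜.card := by exact_mod_cast Finset.card_pos.2 h𝒜.nonempty
  rw [inv_mul_le_iff₀ hcard']
  refine (norm_sum_le_of_le _ hA).trans ?_
  rw [Finset.sum_const, nsmul_eq_mul]

lemma trace_runOutput (hH : H.IsHermitian) (hσ : 0 < σ) :
    (runOutput H A σ T α ω ρ).trace = ρ.trace := by
  have h := trace_mul_partialTrace (1 : Matrix (Fin N) (Fin N) ℂ)
    (evolution H A ω σ α T * (ρ ⊗ₖ bathGround ω) * (evolution H A ω σ α T)ᴴ)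
  rw [one_mul, Matrix.one_kronecker_one, one_mul, Matrix.trace_mul_comm, ← mul_assoc,
    evolution_conjTranspose_mul_self hH hσ, one_mul, Matrix.trace_kronecker, trace_bathGround,
    mul_one] at h
  exact h

lemma trace_channel (hH : H.IsHermitian) (hσ : 0 < σ) (h𝒜 : IsAdmissible 𝒜 g)
    (ρ : Matrix (Fin N) (Fin N) ℂ) : (channel H 𝒜 g σ T α ρ).trace = ρ.trace := by
  have := norm_functional_channel_sub_le (T := T) (α := α) (ρ := ρ) (c := 0) (z := ρ.trace) hH hσ
    h𝒜 (Matrix.traceLinearMap (Fin N) ℂ ℂ) fun A _ ω => by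
      simp [trace_runOutput hH hσ]
  simpa [sub_eq_zero] using this

lemma isDensity_channel (hH : H.IsHermitian) (hσ : 0 < σ) (h𝒜 : IsAdmissible 𝒜 g)
    (hρ : IsDensity ρ) : IsDensity (channel H 𝒜 g σ T α ρ) :=
  ⟨posSemidef_channel h𝒜.density_nonneg hρ.1, (trace_channel hH hσ h𝒜 ρ).trans hρ.2⟩

/-- The channel contracts the trace distance. -/
lemma traceNorm_channel_sub_le (hH : H.IsHermitian) (hσ : 0 < σ) (h𝒜 : IsAdmissible 𝒜 g)
    (hρ : IsDensity ρ) (hρ' : IsDensity ρ') :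
    traceNorm (channel H 𝒜 g σ T α ρ - channel H 𝒜 g σ T α ρ') ≤ traceNorm (ρ - ρ') := by
  have hg := h𝒜.density_integrable
  obtain ⟨A, B, hA, hB, hAB, htr⟩ :=
    exists_posSemidef_decomposition (hρ.1.isHermitian.sub hρ'.1.isHermitian)
  have hsum : ρ + B = ρ' + A := by
    rw [sub_eq_sub_iff_add_eq_add] at hAB
    rw [hAB, add_comm]
  have hch : channel H 𝒜 g σ T α ρ - channel H 𝒜 g σ T α ρ' =
      channel H 𝒜 g σ T α A - channel H 𝒜 g σ T α B := by
    have h1 := channel_add (𝒜 := 𝒜) (T := T) (α := α) hH hσ hg ρ B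
    have h2 := channel_add (𝒜 := 𝒜) (T := T) (α := α) hH hσ hg ρ' A
    rw [hsum, h2] at h1
    rw [sub_eq_sub_iff_add_eq_add, ← h1, add_comm]
  have hA' := posSemidef_channel (H := H) (𝒜 := 𝒜) (σ := σ) (T := T) (α := α)
    h𝒜.density_nonneg hA
  have hB' := posSemidef_channel (H := H) (𝒜 := 𝒜) (σ := σ) (T := T) (α := α)
    h𝒜.density_nonneg hB
  have hpos : ∀ {M : Matrix (Fin N) (Fin N) ℂ}, M.PosSemidef →
      traceNorm M = M.trace.re := fun hM => by
    rw [traceNorm, CFC.abs_of_nonneg _ (Matrix.nonneg_iff_posSemidef.2 hM)]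
  have hneg : traceNorm (-channel H 𝒜 g σ T α B) = traceNorm (channel H 𝒜 g σ T α B) := by
    rw [traceNorm, CFC.abs_neg, traceNorm]
  rw [hch, sub_eq_add_neg]
  refine (traceNorm_add_le hA'.isHermitian hB'.isHermitian.neg).trans ?_
  rw [hneg, hpos hA', hpos hB', trace_channel hH hσ h𝒜, trace_channel hH hσ h𝒜, htr]

end Nonempty

end Channel

/-! ### Preservation of the ground state -/

section GroundState

/-- The factor in front of `α² σ δ` in the bound on the trace distance between
`Φ_α(|ψ₀⟩⟨ψ₀|)` and `|ψ₀⟩⟨ψ₀|`, where `δ` is the damping factor of the excited sector. -/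
def leakageConst (K : ℝ) : ℝ := 256 * Real.exp (32 * K) * (8 + 4 * (16 * K) ^ 2)

lemma one_le_leakageConst {K : ℝ} (hK : 0 < K) : 1 ≤ leakageConst K := by
  have h : 1 ≤ Real.exp (32 * K) := Real.one_le_exp (by positivity)
  unfold leakageConst
  nlinarith [sq_nonneg K, mul_nonneg (zero_le_one.trans h) (sq_nonneg (16 * K))]

/-- In the regime `x ≤ κ`, `δ ≤ 2`, all four error terms of a single run are of order `δ x²`. -/
lemma single_run_bound_le {x κ δ : ℝ} (hx : 0 ≤ x) (hxκ : x ≤ κ) (hδ : 0 ≤ δ) (hδ2 : δ ≤ 2) :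
    2 * (δ * (x ^ 2 * Real.exp x)) + 2 * (δ * (x ^ 2 * Real.exp x)) ^ 2 +
      (2 * (x * Real.exp x * (δ * (x ^ 1 * Real.exp x))) + 2 * (δ * (x ^ 1 * Real.exp x)) ^ 2) ≤
      δ * x ^ 2 * (Real.exp (2 * κ) * (8 + 4 * κ ^ 2)) := by
  have hE1 : 1 ≤ Real.exp x := Real.one_le_exp hx
  have hEκ : Real.exp x ^ 2 ≤ Real.exp (2 * κ) := by
    rw [← Real.exp_nat_mul]
    exact Real.exp_le_exp.2 (by push_cast; linarith)
  set E := Real.exp x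
  have h1 : δ * x ^ 2 * E ≤ δ * x ^ 2 * E ^ 2 :=
    mul_le_mul_of_nonneg_left (by nlinarith) (by positivity)
  have hx2 : x ^ 2 ≤ κ ^ 2 := pow_le_pow_left₀ hx hxκ 2
  have h2 : δ * x ^ 2 * E ^ 2 * (δ * x ^ 2) ≤ δ * x ^ 2 * E ^ 2 * (2 * κ ^ 2) :=
    mul_le_mul_of_nonneg_left (mul_le_mul hδ2 hx2 (by positivity) (by norm_num)) (by positivity)
  have h3 : δ * x ^ 2 * E ^ 2 * δ ≤ δ * x ^ 2 * E ^ 2 * 2 :=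
    mul_le_mul_of_nonneg_left hδ2 (by positivity)
  have h4 : δ * x ^ 2 * (E ^ 2 * (8 + 4 * κ ^ 2)) ≤
      δ * x ^ 2 * (Real.exp (2 * κ) * (8 + 4 * κ ^ 2)) := by gcongr
  nlinarith

variable {N : ℕ} {H : Matrix (Fin N) (Fin N) ℂ} {Δ : ℝ} {ψ₀ : Fin N → ℂ}
  {𝒜 : Finset (Matrix (Fin N) (Fin N) ℂ)} {g : ℝ → ℝ} {σ T α K : ℝ}

lemma HasGappedGroundState.nonempty (h : HasGappedGroundState H Δ ψ₀) : Nonempty (Fin N) := by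
  by_contra hN
  rw [not_nonempty_iff] at hN
  simpa [dotProduct] using h.unit

/-- One application of the channel moves the ground state by at most `O(α² σ δ)`. -/
lemma traceNorm_channel_ketbra_sub_le (h : HasGappedGroundState H Δ ψ₀)
    (h𝒜 : IsAdmissible 𝒜 g) (hσ : 0 < σ) (hα : 0 < α) (hαK : α ≤ K * σ ^ (-(1 / 2) : ℝ))
    (hT : 0 ≤ T) :
    traceNorm (channel H 𝒜 g σ T α (ketbra ψ₀) - ketbra ψ₀) ≤
      leakageConst K * α ^ 2 * σ *
        (Real.exp (-(Δ * σ)) + Real.exp (-T ^ 2 / (8 * σ ^ 2))) := by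
  have := h.nonempty
  set δ := Real.exp (-(Δ * σ)) + Real.exp (-T ^ 2 / (8 * σ ^ 2)) with hδ
  have hsq : √σ ^ 2 = σ := Real.sq_sqrt hσ.le
  have hαs : α * √σ ≤ K := by
    have hs : σ ^ (-(1 / 2) : ℝ) * √σ = 1 := by
      rw [Real.sqrt_eq_rpow, ← Real.rpow_add hσ]
      norm_num
    calc α * √σ ≤ K * σ ^ (-(1 / 2) : ℝ) * √σ := by gcongr
      _ = K := by rw [mul_assoc, hs, mul_one]
  have hδ2 : δ ≤ 2 := by
    have h1 : Real.exp (-(Δ * σ)) ≤ 1 :=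
      Real.exp_le_one_iff.2 (neg_nonpos.2 (mul_pos h.gap_pos hσ).le)
    have h2 : Real.exp (-T ^ 2 / (8 * σ ^ 2)) ≤ 1 :=
      Real.exp_le_one_iff.2 (div_nonpos_of_nonpos_of_nonneg (by nlinarith) (by positivity))
    linarith
  have hb := single_run_bound_le (x := 16 * α * √σ) (κ := 16 * K) (δ := δ) (by positivity)
    (by linarith) (by positivity) hδ2
  refine traceNorm_le_of_forall
    ((posSemidef_channel h𝒜.density_nonneg (isDensity_ketbra h.unit).1).isHermitian.sub
      (isHermitian_ketbra ψ₀)) fun S hS => ?_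
  have hL := norm_functional_channel_sub_le (T := T) (α := α) (ρ := ketbra ψ₀)
    (z := (S * ketbra ψ₀).trace) h.hermitian hσ h𝒜
    ((Matrix.traceLinearMap (Fin N) ℂ ℂ).comp (LinearMap.mulLeft ℂ S)) (fun A hA ω => by
      have hrun := norm_trace_single_run_le h (h𝒜.norm_le_one A hA) hσ hα hT ω rfl hδ hS
      rw [mul_sub, Matrix.trace_sub] at hrun
      exact hrun.trans hb)
  rw [mul_sub, Matrix.trace_sub]
  refine (Complex.re_le_norm _).trans (hL.trans_eq ?_)
  rw [leakageConst, mul_pow, mul_pow, hsq]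
  ring_nf

/-- The constant in the lower bounds on `σ` and `T`; it makes the powers of `2 + z` gained from the
logarithms beat the leakage constant. -/
def thresholdConst (K : ℝ) : ℝ := 4 + 32 * leakageConst K

/-- An exponent above `C / 4 · log (2 + z)` beats `z` and the leakage constant. -/
lemma leakageConst_mul_exp_neg_le (hK : 0 < K) {v z : ℝ} (hz : 0 ≤ z)
    (hv : thresholdConst K / 4 * Real.log (2 + z) ≤ v) :
    leakageConst K * Real.exp (-v) ≤ 1 / (4 * (2 + z)) := by
  have hB := one_le_leakageConst hK
  set B := leakageConst K with hBdef
  have hL : 1 / 2 ≤ Real.log (2 + z) := by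
    have h1 := Real.log_two_gt_d9
    have h2 := Real.log_le_log (by norm_num) (by linarith : (2 : ℝ) ≤ 2 + z)
    linarith
  have hz2 : 0 < 2 + z := by linarith
  have h3 : Real.log (2 + z) + 4 * B ≤ v := by
    unfold thresholdConst at hv
    nlinarith
  have h4 : 4 * B * (2 + z) ≤ Real.exp v := by
    calc 4 * B * (2 + z) ≤ Real.exp (4 * B) * (2 + z) := by
          gcongr
          linarith [Real.add_one_le_exp (4 * B)]
      _ = Real.exp (Real.log (2 + z) + 4 * B) := by
          rw [Real.exp_add, Real.exp_log hz2, mul_comm]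
      _ ≤ Real.exp v := Real.exp_le_exp.2 h3
  rw [Real.exp_neg, ← div_eq_mul_inv, div_le_div_iff₀ (Real.exp_pos v) (by positivity)]
  linarith

/-- The gap condition on `σ` makes the part of the leakage damped by the contour shift smaller than
`ε / 2`. -/
lemma leakageConst_mul_exp_gap_lt (h : HasGappedGroundState H Δ ψ₀) (hK : 0 < K) (hσ : 0 < σ)
    {ε : ℝ} (hε : 0 < ε)
    (hσC : thresholdConst K * Δ⁻¹ * Real.log (2 + ‖H‖ / (Δ ^ 2 * ε)) ^ (3 / 2 : ℝ) ≤ σ) :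
    leakageConst K * σ * Real.exp (-(Δ * σ)) < ε / 2 := by
  have hΔ := h.gap_pos
  have hB := one_le_leakageConst hK
  set y := ‖H‖ / (Δ ^ 2 * ε) with hy
  have hy1 : 1 / (2 * (Δ * ε)) ≤ y := by
    rw [hy, div_le_div_iff₀ (by positivity) (by positivity)]
    nlinarith [mul_le_mul_of_nonneg_right h.gap_le_two_mul_norm (mul_pos hΔ hε).le]
  have hy0 : 0 < y := lt_of_lt_of_le (by positivity) hy1
  have hL : 1 / 4 ≤ Real.log (2 + y) := by
    have h1 := Real.log_two_gt_d9
    have h2 := Real.log_le_log (by norm_num) (by linarith : (2 : ℝ) ≤ 2 + y)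
    linarith
  have hL32 : Real.log (2 + y) / 2 ≤ Real.log (2 + y) ^ (3 / 2 : ℝ) := by
    have h1 : (1 / 2 : ℝ) ≤ √(Real.log (2 + y)) := Real.le_sqrt_of_sq_le (by linarith)
    have h2 : Real.log (2 + y) ^ (3 / 2 : ℝ) = Real.log (2 + y) * √(Real.log (2 + y)) := by
      rw [Real.sqrt_eq_rpow, ← Real.rpow_one_add' (by linarith) (by norm_num)]
      norm_num
    rw [h2]
    nlinarith
  have hC : 0 < thresholdConst K := by unfold thresholdConst; linarith
  have hu : thresholdConst K / 4 * Real.log (2 + y) ≤ Δ * σ / 2 := by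
    have h1 : thresholdConst K * (Real.log (2 + y) / 2) ≤
        thresholdConst K * Real.log (2 + y) ^ (3 / 2 : ℝ) :=
      mul_le_mul_of_nonneg_left hL32 hC.le
    have h2 := mul_le_mul_of_nonneg_left hσC hΔ.le
    have h3 : Δ * (thresholdConst K * Δ⁻¹ * Real.log (2 + y) ^ (3 / 2 : ℝ)) =
        thresholdConst K * Real.log (2 + y) ^ (3 / 2 : ℝ) := by
      field_simp
    linarith
  have h4 := leakageConst_mul_exp_neg_le hK hy0.le hu
  -- Half of the exponent absorbs the factor `Δ σ`, the other half supplies the smallness.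
  have h5 : Δ * σ * Real.exp (-(Δ * σ)) ≤ Real.exp (-(Δ * σ / 2)) := by
    have h6 := Real.quadratic_le_exp_of_nonneg (x := Δ * σ / 2) (by positivity)
    have h7 : Δ * σ ≤ Real.exp (Δ * σ / 2) := by nlinarith [sq_nonneg (Δ * σ / 2 - 1)]
    calc Δ * σ * Real.exp (-(Δ * σ)) ≤ Real.exp (Δ * σ / 2) * Real.exp (-(Δ * σ)) := by gcongr
      _ = Real.exp (-(Δ * σ / 2)) := by rw [← Real.exp_add]; ring_nf
  have h8 : 1 / (4 * (2 + y)) < Δ * ε / 2 := by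
    rw [div_le_iff₀ (by positivity)] at hy1
    rw [div_lt_iff₀ (by positivity)]
    nlinarith [mul_pos hΔ hε]
  have h9 : Δ * (leakageConst K * σ * Real.exp (-(Δ * σ))) < Δ * (ε / 2) := by
    nlinarith [mul_le_mul_of_nonneg_left h5 (zero_le_one.trans hB)]
  linarith [lt_of_mul_lt_mul_left h9 hΔ.le]

/-- The condition on `T` makes the part of the leakage coming from the truncation of the time
interval at most `ε / 4`. -/
lemma leakageConst_mul_exp_tail_le (hK : 0 < K) (hσ : 0 < σ) {ε : ℝ} (hε : 0 < ε)
    (hTC : thresholdConst K * σ * Real.log (2 + σ / ε) ^ (1 / 2 : ℝ) ≤ T) :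
    leakageConst K * σ * Real.exp (-T ^ 2 / (8 * σ ^ 2)) ≤ ε / 4 := by
  have hB := one_le_leakageConst hK
  have hC : 8 ≤ thresholdConst K := by unfold thresholdConst; linarith
  have hz : 0 < σ / ε := by positivity
  have hL : 0 ≤ Real.log (2 + σ / ε) := Real.log_nonneg (by linarith)
  rw [← Real.sqrt_eq_rpow] at hTC
  have h1 : thresholdConst K / 4 * Real.log (2 + σ / ε) ≤ T ^ 2 / (8 * σ ^ 2) := by
    rw [le_div_iff₀ (by positivity)]
    have h2 := pow_le_pow_left₀ (by positivity) hTC 2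
    rw [mul_pow, mul_pow, Real.sq_sqrt hL] at h2
    have h3 : 2 * thresholdConst K ≤ thresholdConst K ^ 2 := by nlinarith
    nlinarith [mul_le_mul_of_nonneg_right h3 (by positivity :
      0 ≤ σ ^ 2 * Real.log (2 + σ / ε))]
  have h4 := leakageConst_mul_exp_neg_le hK hz.le h1
  rw [← neg_div] at h4
  calc leakageConst K * σ * Real.exp (-T ^ 2 / (8 * σ ^ 2))
      = σ * (leakageConst K * Real.exp (-T ^ 2 / (8 * σ ^ 2))) := by ring
    _ ≤ σ * (1 / (4 * (2 + σ / ε))) := by gcongr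
    _ ≤ σ * (1 / (4 * (σ / ε))) := by gcongr; linarith
    _ = ε / 4 := by field_simp

/-- Ground state preservation, with a threshold constant that does not yet allow for the halving of
`ε` needed to pass to the fixed point. -/
theorem traceNorm_channel_ketbra_sub_lt (h : HasGappedGroundState H Δ ψ₀)
    (h𝒜 : IsAdmissible 𝒜 g) (hK : 0 < K) (hσ : 0 < σ) (hα : 0 < α)
    (hαK : α ≤ K * σ ^ (-(1 / 2) : ℝ)) {ε : ℝ} (hε : 0 < ε)
    (hσC : thresholdConst K * Δ⁻¹ * Real.log (2 + ‖H‖ / (Δ ^ 2 * ε)) ^ (3 / 2 : ℝ) ≤ σ)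
    (hTC : thresholdConst K * σ * Real.log (2 + σ / ε) ^ (1 / 2 : ℝ) ≤ T) :
    traceNorm (channel H 𝒜 g σ T α (ketbra ψ₀) - ketbra ψ₀) < α ^ 2 * ε := by
  have hB := one_le_leakageConst hK
  have hT : 0 ≤ T := by
    have hz : 0 < σ / ε := by positivity
    have hL : 0 ≤ Real.log (2 + σ / ε) := Real.log_nonneg (by linarith)
    refine le_trans ?_ hTC
    unfold thresholdConst
    positivity
  have h1 := leakageConst_mul_exp_gap_lt h hK hσ hε hσC
  have h2 := leakageConst_mul_exp_tail_le hK hσ hε hTC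
  calc traceNorm (channel H 𝒜 g σ T α (ketbra ψ₀) - ketbra ψ₀)
      ≤ leakageConst K * α ^ 2 * σ *
        (Real.exp (-(Δ * σ)) + Real.exp (-T ^ 2 / (8 * σ ^ 2))) :=
        traceNorm_channel_ketbra_sub_le h h𝒜 hσ hα hαK hT
    _ = α ^ 2 * (leakageConst K * σ * Real.exp (-(Δ * σ)) +
        leakageConst K * σ * Real.exp (-T ^ 2 / (8 * σ ^ 2))) := by ring
    _ < α ^ 2 * ε := by gcongr; linarith

end GroundState

/-! ### The fixed point -/

section FixedPoint

variable {N : ℕ} {Φ : Matrix (Fin N) (Fin N) ℂ → Matrix (Fin N) (Fin N) ℂ}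
  {ρ π : Matrix (Fin N) (Fin N) ℂ}

lemma isDensity_iterate (hΦ : ∀ ρ, IsDensity ρ → IsDensity (Φ ρ)) (hρ : IsDensity ρ) (n : ℕ) :
    IsDensity (Φ^[n] ρ) := by
  induction n with
  | zero => exact hρ
  | succ n ih =>
    rw [Function.iterate_succ_apply']
    exact hΦ _ ih

lemma traceNorm_iterate_sub_le (hΦ : ∀ ρ, IsDensity ρ → IsDensity (Φ ρ))
    (hc : ∀ ρ ρ', IsDensity ρ → IsDensity ρ' → traceNorm (Φ ρ - Φ ρ') ≤ traceNorm (ρ - ρ'))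
    (hρ : IsDensity ρ) (n : ℕ) : traceNorm (Φ^[n] ρ - ρ) ≤ n * traceNorm (Φ ρ - ρ) := by
  induction n with
  | zero => simp
  | succ n ih =>
    have hn := isDensity_iterate hΦ hρ n
    have h1 := traceNorm_add_le ((hΦ _ hn).1.isHermitian.sub (hΦ _ hρ).1.isHermitian)
      ((hΦ _ hρ).1.isHermitian.sub hρ.1.isHermitian)
    rw [sub_add_sub_cancel] at h1
    have h2 := hc _ _ hn hρ
    rw [Function.iterate_succ_apply']
    push_cast
    linarith

/-- A state that is almost fixed is close to the fixed point: after one mixing time the distance to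
the fixed point halves, while the state itself has moved by at most `τ ‖Φ π - π‖₁`. -/
lemma traceNorm_sub_le_of_isMixingTime (hΦ : ∀ ρ, IsDensity ρ → IsDensity (Φ ρ))
    (hc : ∀ ρ ρ', IsDensity ρ → IsDensity ρ' → traceNorm (Φ ρ - Φ ρ') ≤ traceNorm (ρ - ρ'))
    {τ : ℕ} (hτ : IsMixingTime Φ τ) (hρ : IsDensity ρ) (hfix : Φ ρ = ρ) (hπ : IsDensity π) :
    traceNorm (ρ - π) ≤ 2 * (τ * traceNorm (Φ π - π)) := by
  have h1 := hτ.1 ρ π hρ hπ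
  rw [Function.iterate_fixed hfix] at h1
  have hn := isDensity_iterate hΦ hπ τ
  have h2 := traceNorm_add_le (hρ.1.isHermitian.sub hn.1.isHermitian)
    (hn.1.isHermitian.sub hπ.1.isHermitian)
  rw [sub_add_sub_cancel] at h2
  have h3 := traceNorm_iterate_sub_le hΦ hc hπ τ
  linarith

/-- Halving `ε` in a logarithmic threshold costs only a constant factor. -/
lemma log_two_add_two_mul_rpow_le {z p : ℝ} (hz : 0 ≤ z) (hp : 0 ≤ p) (hp2 : p ≤ 2) :
    Real.log (2 + 2 * z) ^ p ≤ 4 * Real.log (2 + z) ^ p := by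
  have h1 : Real.log (2 + 2 * z) ≤ 2 * Real.log (2 + z) := by
    rw [← Nat.cast_two, ← Real.log_pow, Nat.cast_two]
    exact Real.log_le_log (by linarith) (by nlinarith)
  have h2 : 0 ≤ Real.log (2 + z) := Real.log_nonneg (by linarith)
  have h3 : (2 : ℝ) ^ p ≤ 4 := by
    calc (2 : ℝ) ^ p ≤ 2 ^ (2 : ℝ) := Real.rpow_le_rpow_of_exponent_le (by norm_num) hp2
      _ = 4 := by norm_num
  calc Real.log (2 + 2 * z) ^ p ≤ (2 * Real.log (2 + z)) ^ p :=
        Real.rpow_le_rpow (Real.log_nonneg (by linarith)) h1 hp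
    _ = 2 ^ p * Real.log (2 + z) ^ p := Real.mul_rpow (by norm_num) h2
    _ ≤ 4 * Real.log (2 + z) ^ p := by gcongr

end FixedPoint

end

end SystemBath

theorem mainTheorem2 (K : ℝ) (hK : 0 < K) :
    ∃ C : ℝ, 0 < C ∧
      ∀ (N : ℕ) (H : Matrix (Fin N) (Fin N) ℂ) (Δ : ℝ) (ψ₀ : Fin N → ℂ)
        (𝒜 : Finset (Matrix (Fin N) (Fin N) ℂ)) (g : ℝ → ℝ) (σ T α : ℝ),
        SystemBath.HasGappedGroundState H Δ ψ₀ →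
        SystemBath.IsAdmissible 𝒜 g →
        0 < σ → 0 < α → α ≤ K * σ ^ (-(1 / 2) : ℝ) →
        (∀ ε : ℝ, 0 < ε →
          C * Δ⁻¹ * Real.log (2 + ‖H‖ / (Δ ^ 2 * ε)) ^ (3 / 2 : ℝ) ≤ σ →
          C * σ * Real.log (2 + σ / ε) ^ (1 / 2 : ℝ) ≤ T →
          SystemBath.traceNorm
            (SystemBath.channel H 𝒜 g σ T α (SystemBath.ketbra ψ₀) - SystemBath.ketbra ψ₀)
              < α ^ 2 * ε) ∧
        (∀ (τ : ℕ) (ρ : Matrix (Fin N) (Fin N) ℂ) (ε : ℝ), 0 < ε →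
          SystemBath.IsMixingTime (SystemBath.channel H 𝒜 g σ T α) τ →
          SystemBath.IsDensity ρ → SystemBath.channel H 𝒜 g σ T α ρ = ρ →
          C * Δ⁻¹ * Real.log (2 + ‖H‖ * (α ^ 2 * τ) / (Δ ^ 2 * ε)) ^ (3 / 2 : ℝ) ≤ σ →
          C * σ * Real.log (2 + σ * (α ^ 2 * τ) / ε) ^ (1 / 2 : ℝ) ≤ T →
          SystemBath.traceNorm (ρ - SystemBath.ketbra ψ₀) ≤ ε) := by
  have hC₀ : 0 < SystemBath.thresholdConst K := by
    have := SystemBath.one_le_leakageConst hK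
    unfold SystemBath.thresholdConst
    linarith
  -- The factor 4 is what halving `ε` costs in the second part.
  refine ⟨4 * SystemBath.thresholdConst K, by positivity, ?_⟩
  intro N H Δ ψ₀ 𝒜 g σ T α h h𝒜 hσ hα hαK
  have hΔ := h.gap_pos
  refine ⟨fun ε hε hσC hTC => ?_, fun τ ρ ε hε hτ hρ hfix hσC hTC => ?_⟩
  · refine SystemBath.traceNorm_channel_ketbra_sub_lt h h𝒜 hK hσ hα hαK hε
      (le_trans ?_ hσC) (le_trans ?_ hTC)
    · have : 0 ≤ Real.log (2 + ‖H‖ / (Δ ^ 2 * ε)) :=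
        Real.log_nonneg (by linarith [show 0 ≤ ‖H‖ / (Δ ^ 2 * ε) by positivity])
      gcongr
      linarith
    · have : 0 ≤ Real.log (2 + σ / ε) :=
        Real.log_nonneg (by linarith [show 0 ≤ σ / ε by positivity])
      gcongr
      linarith
  · have := h.nonempty
    have hclose := SystemBath.traceNorm_sub_le_of_isMixingTime
      (fun ρ hρ => SystemBath.isDensity_channel h.hermitian hσ h𝒜 hρ)
      (fun ρ ρ' hρ hρ' => SystemBath.traceNorm_channel_sub_le h.hermitian hσ h𝒜 hρ hρ')
      hτ hρ hfix (SystemBath.isDensity_ketbra h.unit)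
    rcases Nat.eq_zero_or_pos τ with rfl | hτ0
    · exact hclose.trans (by simpa using hε.le)
    · have hτ' : (0 : ℝ) < τ := Nat.cast_pos.2 hτ0
      have hstep := SystemBath.traceNorm_channel_ketbra_sub_lt (T := T) (ε := ε / (2 * (α ^ 2 * τ)))
        h h𝒜 hK hσ hα hαK (by positivity) ?_ ?_
      · calc SystemBath.traceNorm (ρ - SystemBath.ketbra ψ₀)
            ≤ 2 * (τ * (α ^ 2 * (ε / (2 * (α ^ 2 * τ))))) := by
              refine hclose.trans ?_
              gcongr
          _ = ε := by field_simp
      · refine le_trans ?_ hσC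
        have he : ‖H‖ / (Δ ^ 2 * (ε / (2 * (α ^ 2 * τ)))) =
            2 * (‖H‖ * (α ^ 2 * τ) / (Δ ^ 2 * ε)) := by field_simp
        have hl := SystemBath.log_two_add_two_mul_rpow_le (p := 3 / 2)
          (show 0 ≤ ‖H‖ * (α ^ 2 * τ) / (Δ ^ 2 * ε) by positivity) (by norm_num) (by norm_num)
        rw [he]
        calc _ ≤ SystemBath.thresholdConst K * Δ⁻¹ * _ :=
              mul_le_mul_of_nonneg_left hl (by positivity)
          _ = _ := by ring
      · refine le_trans ?_ hTC
        have he : σ / (ε / (2 * (α ^ 2 * τ))) = 2 * (σ * (α ^ 2 * τ) / ε) := by field_simp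
        have hl := SystemBath.log_two_add_two_mul_rpow_le (p := 1 / 2)
          (show 0 ≤ σ * (α ^ 2 * τ) / ε by positivity) (by norm_num) (by norm_num)
        rw [he]
        calc _ ≤ SystemBath.thresholdConst K * σ * _ :=
              mul_le_mul_of_nonneg_left hl (by positivity)
          _ = _ := by ring
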